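/- Let $D$ be a closed convex subset of the closed unit disc $\mathbb U\subset\mathbb C$ with $1\in D$, and let $\chi:[0,\infty)\to D$ be a measurable function with $\chi(t)=1$ for $0\le t\le 1$. Let $\sigma:[0,\infty)\to\mathbb C$ be the (locally integrable) solution of $$u\,\sigma(u)=\int_0^u\sigma(t)\,\chi(u-t)\,dt\quad(u\ge 0),\qquad \sigma(u)=1\ \text{ for } 0\le u\le 1,$$ and for $u\ge 0$ put $$M(u)=\min_{y\in\mathbb R}\int_0^u\frac{1-\operatorname{Re}\big(\chi(v)e^{-ivy}\big)}{v}\,dv .$$ Then this minimum is attained, and, with $\gamma$ Euler's constant, $$|\sigma(u)|\le\Big(M(u)+\frac{12}{7}\Big)e^{\gamma-M(u)}\qquad\text{for all }u\ge 0 .$$ Moreover, this is best possible up to a factor $10$ in the following sense: for every real $m_0$ there are $D$, $\chi$ and $\sigma$ as above and $u\ge 0$ such that $$M(u)>m_0\quad\text{and}\quad|\sigma(u)|\ge\frac{1}{10}\Big(M(u)+\frac{12}{7}\Big)e^{\gamma-M(u)} .$$ -/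

import Mathlib

namespace MeanValue

/-- A closed convex subset `D` of the closed unit disc of `ℂ` which contains `1`. -/
structure IsRegion (D : Set ℂ) : Prop where
  closed : IsClosed D
  convex : Convex ℝ D
  subset_disc : D ⊆ Metric.closedBall 0 1
  one_mem : (1 : ℂ) ∈ D

/-- `χ : [0, ∞) → D` is (Lebesgue) measurable and `χ t = 1` for `0 ≤ t ≤ 1`.
Only the values of `χ` on `[0, ∞)` matter. -/
structure IsKernelIn (D : Set ℂ) (χ : ℝ → ℂ) : Prop where
  measurable : AEMeasurable χ (MeasureTheory.volume.restrict (Set.Ici 0))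
  mem : ∀ t : ℝ, 0 ≤ t → χ t ∈ D
  eq_one : ∀ t : ℝ, 0 ≤ t → t ≤ 1 → χ t = 1

/-- `σ : [0, ∞) → ℂ` solves `u σ(u) = ∫₀ᵘ σ(t) χ(u - t) dt` for all `u ≥ 0`, with
`σ(u) = 1` for `0 ≤ u ≤ 1`. Local integrability of `σ` is what gives the convolution a
meaning; continuity of `σ` on `[0, ∞)` then follows from the equation. -/
structure IsSolution (χ σ : ℝ → ℂ) : Prop where
  integrable : ∀ u : ℝ, 0 ≤ u → IntervalIntegrable σ MeasureTheory.volume 0 u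
  initial : ∀ u : ℝ, 0 ≤ u → u ≤ 1 → σ u = 1
  equation : ∀ u : ℝ, 0 ≤ u → (u : ℂ) * σ u = ∫ t in (0 : ℝ)..u, σ t * χ (u - t)

/-- `∫₀ᵘ (1 - Re (χ(v) e^{-ivy})) / v dv`. -/
noncomputable def twistedDistance (χ : ℝ → ℂ) (u y : ℝ) : ℝ :=
  ∫ v in (0 : ℝ)..u, (1 - (χ v * Complex.exp (-(Complex.I * v * y))).re) / v

/-- `M(u)`, the infimum over real `y` of `∫₀ᵘ (1 - Re (χ(v) e^{-ivy})) / v dv`. -/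
noncomputable def minDistance (χ : ℝ → ℂ) (u : ℝ) : ℝ :=
  ⨅ y : ℝ, twistedDistance χ u y

end MeanValue

/-!
Halász's theorem for the equation `u σ(u) = ∫₀ᵘ σ(t) χ(u - t) dt`.

*Upper bound.* Fix `u`, cut `χ` off beyond `u` and let `s` be the corresponding solution, which
agrees with `σ` on `[0, u]`. In terms of the Laplace transforms `F` of `s` and `X` of the kernel the
equation says `F' = -F X`. Since `E(z) = ∫₀ᵘ (1 - χ(v) e^{-zv}) / v dv` (`logFactor`) satisfies
`E' = X`, the product `F exp E` is constant for `Re z > 0`, and comparison with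
`Ein x = log x + γ + o(1)` as `z = x → ∞` gives `F = u e^γ exp (-E)`
(`IsTruncatedPair.laplace_s_eq`). The right-hand side is entire, and on the imaginary axis its
absolute value is `u e^{γ - twistedDistance}`. The Phragmén–Lindelöf principle then yields
`|F| ≤ u e^{γ - M}` in the right half-plane (`IsTruncatedPair.norm_laplace_le_of_le`); trivially
also `|F(z)| ≤ 1 / Re z`.

As `t s(t)` is a convolution with transform `F X`, Plancherel's theorem and the Cauchy–Schwarz
inequality bound `∫₀ᵘ t |s(t)| e^{-xt} dt` by `sup |F(x/2 + iy)|` times `∫₀ᵘ e^{-xt} dt`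
(`IsTruncatedPair.lintegral_mul_exp_le`). Integrating over `x ∈ (0, ∞)` and inserting the smaller of
the two bounds for `F` gives `u |σ(u)| ≤ ∫₀ᵘ |σ| ≤ N (Ein (2 u / N) + 1)` with `N = u e^{γ - M}`,
that is `|σ(u)| ≤ (M + log 2 + 1 + o(1)) e^{γ - M}`. Here `log 2 + 1 < 12 / 7`, and the error term is
small enough unless `M ≤ 3 / 2`, where the claim follows from `|σ| ≤ 1`.

The minimum over `y` is attained because the twisted distance is continuous in `y` and, by the
Riemann–Lebesgue lemma, tends to infinity.

*Optimality.* Let `χ₀` be `1` on `[0, 1]` and `i` on `(1, u]`. Then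
`M ≥ log u - sup |∫ sin w / w dw|`, while `|F X|(x) ≥ e^γ (1 / x - O(1) - 1 / (x² u))` for `x > 0`.
Integrating the latter over `x` shows `∫₀ᵀ |σ₀| ≥ e^γ log T - O(1)` for `T = u / 20`
(`IsTruncatedPair.mul_log_le_integral_norm`). Changing the kernel on `[19 T, 20 T]` into the
conjugate phases of `σ₀(20 T - v)` does not affect `σ` on `[0, T]`, makes `u σ(u)` at least this
large up to `O(1)`, and changes `M` only by a small constant (`exists_resonant_lower_bound`).
-/

open MeasureTheory Set Filter Topology

namespace MeanValue

/-! ### Volterra inequalities, uniqueness and boundedness of solutions -/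

/-- A nonnegative function bounded by its own primitive vanishes: iterating the inequality gives
`d x ≤ C xⁿ / n!` for all `n`. No continuity of `d` is needed. -/
theorem eq_zero_of_le_integral {d : ℝ → ℝ} {U : ℝ} (hd : ∀ x, 0 ≤ d x)
    (hint : IntervalIntegrable d volume 0 U)
    (hle : ∀ x, 0 ≤ x → x ≤ U → d x ≤ ∫ t in (0 : ℝ)..x, d t) :
    ∀ x, 0 ≤ x → x ≤ U → d x = 0 := by
  have hsub : ∀ {x}, 0 ≤ x → x ≤ U → IntervalIntegrable d volume 0 x := fun {x} h0 hU =>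
    hint.mono_set (by rw [uIcc_of_le h0, uIcc_of_le (h0.trans hU)]; exact Icc_subset_Icc_right hU)
  set C := ∫ t in (0 : ℝ)..U, d t with hC
  have key : ∀ n : ℕ, ∀ x, 0 ≤ x → x ≤ U → d x ≤ C * (x ^ n / n.factorial) := by
    intro n
    induction n with
    | zero =>
      intro x h0 hU
      have := intervalIntegral.integral_mono_interval (le_refl (0:ℝ)) h0 hU
        (Eventually.of_forall hd) hint
      simpa using (hle x h0 hU).trans this
    | succ n ih =>
      intro x h0 hU
      refine (hle x h0 hU).trans ?_
      have : ∫ t in (0 : ℝ)..x, d t ≤ ∫ t in (0 : ℝ)..x, C * (t ^ n / n.factorial) := by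
        refine intervalIntegral.integral_mono_on h0 (hsub h0 hU)
          (Continuous.intervalIntegrable (by fun_prop) _ _) fun t ht => ih t ht.1 (ht.2.trans hU)
      refine this.trans (le_of_eq ?_)
      rw [intervalIntegral.integral_const_mul, intervalIntegral.integral_div, integral_pow,
        Nat.factorial_succ]
      push_cast
      have : (n.factorial : ℝ) ≠ 0 := by positivity
      field_simp
      simp
  intro x h0 hU
  refine le_antisymm ?_ (hd x)
  have := (FloorSemiring.tendsto_pow_div_factorial_atTop x).const_mul C
  rw [mul_zero] at this
  exact ge_of_tendsto' this fun n => key n x h0 hU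

/-- The functions that can serve as kernels: measurable, bounded by `1`, and equal to `1` on
`[0, 1]`. -/
structure IsUnitKernel (χ : ℝ → ℂ) : Prop where
  measurable : AEMeasurable χ (volume.restrict (Ici 0))
  norm_le : ∀ t, 0 ≤ t → ‖χ t‖ ≤ 1
  eq_one : ∀ t, 0 ≤ t → t ≤ 1 → χ t = 1

theorem IsKernelIn.isUnitKernel {D : Set ℂ} {χ : ℝ → ℂ} (h : IsKernelIn D χ) (hD : IsRegion D) :
    IsUnitKernel χ :=
  ⟨h.measurable, fun t ht => by simpa using hD.subset_disc (h.mem t ht), h.eq_one⟩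

theorem IsUnitKernel.aestronglyMeasurable_comp_sub {χ : ℝ → ℂ} (hχ : IsUnitKernel χ) (x : ℝ) :
    AEStronglyMeasurable (fun t => χ (x - t)) (volume.restrict (Ioc 0 x)) := by
  have h1 : AEStronglyMeasurable χ (volume.restrict (Ici 0)) := hχ.measurable.aestronglyMeasurable
  have h2 : AEStronglyMeasurable ((Ici (0:ℝ)).indicator χ) volume :=
    (aestronglyMeasurable_indicator_iff measurableSet_Ici).2 h1
  have h3 := (h2.comp_measurePreserving (Measure.measurePreserving_sub_left volume x)).restrict
    (s := Ioc 0 x)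
  refine h3.congr ?_
  filter_upwards [ae_restrict_mem measurableSet_Ioc] with t ht
  simp [ht.2]

theorem IsUnitKernel.intervalIntegrable_mul {χ σ : ℝ → ℂ} (hχ : IsUnitKernel χ) {x : ℝ}
    (hx : 0 ≤ x) (hσ : IntervalIntegrable σ volume 0 x) :
    IntervalIntegrable (fun t => σ t * χ (x - t)) volume 0 x := by
  rw [intervalIntegrable_iff_integrableOn_Ioc_of_le hx] at *
  refine Integrable.mul_bdd (c := 1) hσ (hχ.aestronglyMeasurable_comp_sub x) ?_
  filter_upwards [ae_restrict_mem measurableSet_Ioc] with t ht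
  exact hχ.norm_le _ (by linarith [ht.2])

theorem norm_integral_mul_kernel_le {χ σ : ℝ → ℂ} (hχ : IsUnitKernel χ) {x : ℝ} (hx : 0 ≤ x)
    (hσ : IntervalIntegrable σ volume 0 x) :
    ‖∫ t in (0 : ℝ)..x, σ t * χ (x - t)‖ ≤ ∫ t in (0 : ℝ)..x, ‖σ t‖ := by
  refine intervalIntegral.norm_integral_le_of_norm_le hx ?_ hσ.norm
  filter_upwards with t ht
  rw [norm_mul]
  exact mul_le_of_le_one_right (norm_nonneg _) (hχ.norm_le _ (by linarith [ht.2]))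

/-- The equation makes the excess `max (‖σ‖ - 1) 0`, which vanishes on `[0, 1]`, bounded by its own
primitive. -/
theorem IsSolution.norm_le_one {χ σ : ℝ → ℂ} (hχ : IsUnitKernel χ) (hσ : IsSolution χ σ)
    {x : ℝ} (hx : 0 ≤ x) : ‖σ x‖ ≤ 1 := by
  have hi : ∀ {y}, 0 ≤ y → IntervalIntegrable (fun t => max (‖σ t‖ - 1) 0) volume 0 y := by
    intro y hy
    have h := (hσ.integrable y hy).norm.sub (intervalIntegrable_const (c := (1:ℝ)))
    have h0 := intervalIntegrable_const (μ := volume) (a := 0) (b := y) (c := (0:ℝ))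
    exact ⟨Integrable.sup h.1 h0.1, Integrable.sup h.2 h0.2⟩
  have key := eq_zero_of_le_integral (d := fun t => max (‖σ t‖ - 1) 0) (U := x)
    (fun t => le_max_right _ _) (hi hx) ?_ x hx le_rfl
  · have := le_max_left (‖σ x‖ - 1) 0
    linarith
  intro y hy _
  have hnn : 0 ≤ ∫ t in (0 : ℝ)..y, max (‖σ t‖ - 1) 0 :=
    intervalIntegral.integral_nonneg hy fun t _ => le_max_right _ _
  refine max_le ?_ hnn
  rcases le_total y 1 with h1 | h1
  · rw [hσ.initial y hy h1]; simpa using hnn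
  have h2 : y * (‖σ y‖ - 1) ≤ ∫ t in (0 : ℝ)..y, max (‖σ t‖ - 1) 0 := by
    have e := norm_integral_mul_kernel_le hχ hy (hσ.integrable y hy)
    rw [← hσ.equation y hy, norm_mul, Complex.norm_real, Real.norm_of_nonneg hy] at e
    have : ∫ t in (0 : ℝ)..y, (‖σ t‖ - 1) ≤ ∫ t in (0 : ℝ)..y, max (‖σ t‖ - 1) 0 :=
      intervalIntegral.integral_mono_on hy
        ((hσ.integrable y hy).norm.sub intervalIntegrable_const) (hi hy)
        fun t _ => le_max_left _ _
    rw [intervalIntegral.integral_sub (hσ.integrable y hy).norm intervalIntegrable_const] at this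
    simp at this
    linarith
  by_contra hcon
  push Not at hcon
  nlinarith

/-- A solution on `[0, U]` depends only on the kernel on `[0, U]`. -/
theorem IsSolution.eq_of_eqOn {χ χ' σ σ' : ℝ → ℂ} {U : ℝ} (hχ : IsUnitKernel χ)
    (hσ : IsSolution χ σ) (hσ' : IsSolution χ' σ')
    (h : ∀ t, 0 ≤ t → t < U → χ t = χ' t) {x : ℝ} (hx : 0 ≤ x) (hxU : x ≤ U) :
    σ x = σ' x := by
  have hi : ∀ {y}, 0 ≤ y → IntervalIntegrable (fun t => σ t - σ' t) volume 0 y :=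
    fun hy => (hσ.integrable _ hy).sub (hσ'.integrable _ hy)
  have key := eq_zero_of_le_integral (d := fun t => ‖σ t - σ' t‖) (U := x)
    (fun t => norm_nonneg _) (hi hx).norm ?_ x hx le_rfl
  · simpa [sub_eq_zero] using key
  intro y hy hyx
  have hnn : 0 ≤ ∫ t in (0 : ℝ)..y, ‖σ t - σ' t‖ :=
    intervalIntegral.integral_nonneg hy fun t _ => norm_nonneg _
  rcases le_total y 1 with h1 | h1
  · simpa [hσ.initial y hy h1, hσ'.initial y hy h1] using hnn
  have e : (y : ℂ) * (σ y - σ' y) = ∫ t in (0 : ℝ)..y, (σ t - σ' t) * χ (y - t) := by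
    have e2 : ∫ t in (0 : ℝ)..y, σ' t * χ' (y - t) = ∫ t in (0 : ℝ)..y, σ' t * χ (y - t) := by
      refine intervalIntegral.integral_congr_ae ?_
      filter_upwards with t ht
      rw [uIoc_of_le hy] at ht
      rw [h (y - t) (by linarith [ht.2]) (by linarith [ht.1])]
    rw [mul_sub, hσ.equation y hy, hσ'.equation y hy, e2, ← intervalIntegral.integral_sub
      (hχ.intervalIntegrable_mul hy (hσ.integrable y hy))
      (hχ.intervalIntegrable_mul hy (hσ'.integrable y hy))]
    simp only [sub_mul]
  have e3 := norm_integral_mul_kernel_le hχ hy (hi hy)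
  rw [← e, norm_mul, Complex.norm_real, Real.norm_of_nonneg hy] at e3
  nlinarith [norm_nonneg (σ y - σ' y)]

/-! ### Existence of solutions -/

open scoped BoundedContinuousFunction

theorem continuous_integral_comp_sub_mul {f g : ℝ → ℂ} (hf : Continuous f) {C : ℝ}
    (hfC : ∀ t, ‖f t‖ ≤ C) (hg : AEStronglyMeasurable g volume) (hg1 : ∀ t, ‖g t‖ ≤ 1) :
    Continuous fun x : ℝ => ∫ t in (0 : ℝ)..x, f (x - t) * g t := by
  rw [continuous_iff_continuousAt]
  intro x
  have := intervalIntegral.continuousAt_parametric_primitive_of_dominated (X := ℝ) (μ := volume)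
    (F := fun x t => f (x - t) * g t) (fun _ => C) (-|x| - 1) (|x| + 1) (a₀ := 0) (b₀ := x)
    (x₀ := x) (fun y => ((by fun_prop : Continuous fun t => f (y - t)).aestronglyMeasurable.mul
      hg).restrict) (Eventually.of_forall fun y => Eventually.of_forall fun t => ?_)
    intervalIntegrable_const (Eventually.of_forall fun t => by fun_prop)
    ⟨by linarith [abs_nonneg x], by linarith [abs_nonneg x]⟩
    ⟨by linarith [neg_abs_le x], by linarith [le_abs_self x]⟩ (by simp)
  · exact ContinuousAt.comp (f := fun x : ℝ => (x, x)) (x := x) this (by fun_prop)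
  · rw [norm_mul]
    exact (mul_le_mul (hfC _) (hg1 _) (norm_nonneg _) ((norm_nonneg _).trans (hfC 0))).trans
      (by simp)

/-- The weighted integral operator whose fixed point `f` gives the solution `σ t = e^{2t} f t`.
The summand `max (1 - x) 0` encodes the initial condition while keeping the image continuous. -/
noncomputable def picardFun (g : ℝ → ℂ) (f : ℝ → ℂ) (x : ℝ) : ℂ :=
  ((max x 1 : ℝ) : ℂ)⁻¹ * (((max (1 - x) 0 * Real.exp (-2 * x) : ℝ) : ℂ) +
    ∫ t in (0 : ℝ)..x, f (x - t) * (g t * (Real.exp (-2 * t) : ℂ)))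

/-- The weight `e^{-2t}` makes `picardFun` a contraction with constant `1 / 2` on bounded continuous
functions; its values at negative arguments are immaterial, so `x` is replaced by `max x 0`. -/
theorem exists_fixedPoint_picardFun {g : ℝ → ℂ} (hg : AEStronglyMeasurable g volume)
    (hg1 : ∀ t, ‖g t‖ ≤ 1) (hg0 : ∀ t < 0, g t = 0) :
    ∃ f : ℝ → ℂ, Continuous f ∧ ∀ x, 0 ≤ x → f x = picardFun g f x := by
  set w : ℝ → ℂ := fun t => g t * (Real.exp (-2 * t) : ℂ) with hw
  have hwm : AEStronglyMeasurable w volume :=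
    hg.mul (by fun_prop : Continuous fun t : ℝ => (Real.exp (-2 * t) : ℂ)).aestronglyMeasurable
  have hwn : ∀ t, 0 ≤ t → ‖w t‖ ≤ Real.exp (-2 * t) := fun t _ => by
    rw [hw]
    simp only [norm_mul, Complex.norm_real, Real.norm_of_nonneg (Real.exp_pos _).le]
    exact mul_le_of_le_one_left (Real.exp_pos _).le (hg1 t)
  have hw1 : ∀ t, ‖w t‖ ≤ 1 := fun t => by
    rcases lt_or_ge t 0 with h | h
    · simp [hw, hg0 t h]
    · exact (hwn t h).trans (Real.exp_le_one_iff.2 (by linarith))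
  have hexp : ∀ x : ℝ, ∫ t in (0:ℝ)..x, Real.exp (-2 * t) = (1 - Real.exp (-2 * x)) / 2 := by
    intro x
    have : ∀ t ∈ uIcc 0 x, HasDerivAt (fun t : ℝ => - Real.exp (-2 * t) / 2)
        (Real.exp (-2 * t)) t := fun t _ => by
      exact ((((hasDerivAt_id t).const_mul (-2)).exp.neg.div_const 2).congr_deriv
        (by simp only [id]; ring))
    rw [intervalIntegral.integral_eq_sub_of_hasDerivAt this
      (Continuous.intervalIntegrable (by fun_prop) _ _)]
    simp; ring
  have hbd : ∀ (f : ℝ → ℂ) (C : ℝ), (∀ t, ‖f t‖ ≤ C) → ∀ x, 0 ≤ x →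
      ‖∫ t in (0 : ℝ)..x, f (x - t) * w t‖ ≤ C / 2 := by
    intro f C hC x hx
    have hC0 : 0 ≤ C := (norm_nonneg _).trans (hC 0)
    have := intervalIntegral.norm_integral_le_of_norm_le (μ := volume)
      (f := fun t => f (x - t) * w t) (g := fun t => C * Real.exp (-2 * t)) hx ?_
      (Continuous.intervalIntegrable (by fun_prop) _ _)
    · refine this.trans ?_
      rw [intervalIntegral.integral_const_mul, hexp]
      nlinarith [Real.exp_pos (-2 * x)]
    · filter_upwards with t ht
      rw [norm_mul]
      exact mul_le_mul (hC _) (hwn t ht.1.le) (norm_nonneg _) hC0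
  have hcont : ∀ f : ℝ →ᵇ ℂ, Continuous fun x => picardFun g f (max x 0) := by
    intro f
    have h1 := continuous_integral_comp_sub_mul f.continuous f.norm_coe_le_norm hwm hw1
    have h2 : Continuous (picardFun g f) := by
      unfold picardFun
      refine Continuous.mul (Continuous.inv₀ (by fun_prop) fun x => ?_)
        (Continuous.add (by fun_prop) h1)
      have : (0:ℝ) < max x 1 := lt_max_of_lt_right one_pos
      exact_mod_cast this.ne'
    exact h2.comp (by fun_prop)
  have hinv : ∀ x : ℝ, ‖((max x 1 : ℝ) : ℂ)⁻¹‖ ≤ 1 := fun x => by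
    rw [norm_inv, Complex.norm_real, Real.norm_of_nonneg (by positivity)]
    exact inv_le_one_of_one_le₀ (le_max_right _ _)
  have hbound : ∀ f : ℝ →ᵇ ℂ, ∀ x, ‖picardFun g f (max x 0)‖ ≤ 1 + ‖f‖ / 2 := by
    intro f x
    have hx : 0 ≤ max x 0 := le_max_right _ _
    unfold picardFun
    rw [norm_mul]
    refine (mul_le_of_le_one_left (norm_nonneg _) (hinv _)).trans ((norm_add_le _ _).trans ?_)
    refine add_le_add ?_ (hbd f _ f.norm_coe_le_norm _ hx)
    rw [Complex.norm_real, Real.norm_of_nonneg (by positivity)]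
    exact mul_le_one₀ (max_le (by linarith) zero_le_one) (Real.exp_pos _).le
      (Real.exp_le_one_iff.2 (by linarith))
  let Φ : (ℝ →ᵇ ℂ) → (ℝ →ᵇ ℂ) := fun f =>
    BoundedContinuousFunction.ofNormedAddCommGroup _ (hcont f) _ (hbound f)
  have hΦ : ContractingWith (1 / 2) Φ := by
    refine ⟨by norm_num, LipschitzWith.of_dist_le_mul fun f h => ?_⟩
    rw [BoundedContinuousFunction.dist_le (by positivity)]
    intro x
    have hx : 0 ≤ max x 0 := le_max_right _ _
    have hii : ∀ f : ℝ →ᵇ ℂ,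
        IntervalIntegrable (fun t => f (max x 0 - t) * w t) volume 0 (max x 0) := by
      intro f
      refine (intervalIntegrable_const (c := ‖f‖)).mono_fun
        ((by fun_prop : Continuous fun t => f (max x 0 - t)).aestronglyMeasurable.mul hwm).restrict
        (Eventually.of_forall fun t => ?_)
      simp only [norm_mul, norm_norm]
      exact (mul_le_mul (f.norm_coe_le_norm _) (hw1 _) (norm_nonneg _) (norm_nonneg _)).trans
        (by simp)
    have e : picardFun g f (max x 0) - picardFun g h (max x 0) =
        ((max (max x 0) 1 : ℝ) : ℂ)⁻¹ *
          ∫ t in (0 : ℝ)..(max x 0), (f - h) (max x 0 - t) * w t := by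
      unfold picardFun
      rw [← mul_sub, add_sub_add_left_eq_sub, ← intervalIntegral.integral_sub (hii f) (hii h)]
      simp [sub_mul]
    change dist (picardFun g f (max x 0)) (picardFun g h (max x 0)) ≤ _
    rw [dist_eq_norm, e, norm_mul]
    refine (mul_le_of_le_one_left (norm_nonneg _) (hinv _)).trans
      ((hbd _ _ (f - h).norm_coe_le_norm _ hx).trans (le_of_eq ?_))
    rw [dist_eq_norm]; push_cast; ring
  refine ⟨hΦ.fixedPoint, (hΦ.fixedPoint).continuous, fun x hx => ?_⟩
  have := congrArg (fun f : ℝ →ᵇ ℂ => f x) hΦ.fixedPoint_isFixedPt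
  simp only [Φ, BoundedContinuousFunction.coe_ofNormedAddCommGroup, max_eq_left hx] at this
  exact this.symm

theorem IsUnitKernel.exists_isSolution {χ : ℝ → ℂ} (hχ : IsUnitKernel χ) :
    ∃ σ, Continuous σ ∧ IsSolution χ σ := by
  set g := (Ici (0:ℝ)).indicator χ with hg
  have hgm : AEStronglyMeasurable g volume :=
    (aestronglyMeasurable_indicator_iff measurableSet_Ici).2 hχ.measurable.aestronglyMeasurable
  obtain ⟨f, hfc, hf⟩ := exists_fixedPoint_picardFun hgm
    (fun t => by
      by_cases h : t ∈ Ici (0:ℝ)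
      · rw [hg, indicator_of_mem h]; exact hχ.norm_le t h
      · rw [hg, indicator_of_notMem h]; simp)
    (fun t ht => by rw [hg, indicator_of_notMem (by simpa using ht)])
  set σ : ℝ → ℂ := fun t => (Real.exp (2 * t) : ℂ) * f t with hσ
  have hσc : Continuous σ := by fun_prop
  have main : ∀ x, 0 ≤ x → ((max x 1 : ℝ) : ℂ) * σ x =
      ((max (1 - x) 0 : ℝ) : ℂ) + ∫ t in (0 : ℝ)..x, σ t * χ (x - t) := by
    intro x hx
    have e1 : ∫ t in (0 : ℝ)..x, σ t * χ (x - t) = (Real.exp (2 * x) : ℂ) *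
        ∫ t in (0 : ℝ)..x, f (x - t) * (g t * (Real.exp (-2 * t) : ℂ)) := by
      rw [← intervalIntegral.integral_const_mul]
      have := intervalIntegral.integral_comp_sub_left (a := 0) (b := x)
        (fun t => σ t * χ (x - t)) x
      simp only [sub_zero, sub_self, sub_sub_cancel] at this
      rw [← this]
      refine intervalIntegral.integral_congr fun t ht => ?_
      rw [uIcc_of_le hx] at ht
      have : g t = χ t := indicator_of_mem (show t ∈ Ici (0:ℝ) from ht.1) _
      simp only [this, hσ]
      have : Real.exp (2 * (x - t)) = Real.exp (2 * x) * Real.exp (-2 * t) := by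
        rw [← Real.exp_add]; ring_nf
      rw [this]; push_cast; ring
    have hm : ((max x 1 : ℝ) : ℂ) ≠ 0 := by
      have : (0:ℝ) < max x 1 := lt_max_of_lt_right one_pos
      exact_mod_cast this.ne'
    rw [e1]
    simp only [hσ]
    have e2 : (Real.exp (2 * x) : ℂ) * (Real.exp (-2 * x) : ℂ) = 1 := by
      rw [← Complex.ofReal_mul, ← Real.exp_add]; simp
    have hfx := hf x hx
    unfold picardFun at hfx
    rw [eq_inv_mul_iff_mul_eq₀ hm] at hfx
    have h3 : ((max x 1 : ℝ) : ℂ) * ((Real.exp (2 * x) : ℂ) * f x) =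
      (Real.exp (2 * x) : ℂ) * (((max x 1 : ℝ) : ℂ) * f x) := by ring
    rw [h3, hfx, mul_add]
    congr 1
    push_cast
    push_cast at e2
    linear_combination ((max (1 - x) 0 : ℝ) : ℂ) * e2
  have hinit : ∀ x, 0 ≤ x → x ≤ 1 → σ x = 1 := by
    intro x hx hx1
    have key := eq_zero_of_le_integral (d := fun t => ‖σ t - 1‖) (U := 1)
      (fun t => norm_nonneg _) (Continuous.intervalIntegrable (by fun_prop) _ _) ?_ x hx hx1
    · simpa [sub_eq_zero] using key
    intro y hy hy1
    have h := main y hy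
    rw [max_eq_right hy1, max_eq_left (by linarith : (0:ℝ) ≤ 1 - y)] at h
    have e : ∫ t in (0 : ℝ)..y, σ t * χ (y - t) = ∫ t in (0 : ℝ)..y, σ t := by
      refine intervalIntegral.integral_congr fun t ht => ?_
      rw [uIcc_of_le hy] at ht
      rw [hχ.eq_one (y - t) (by linarith [ht.2]) (by linarith [ht.1]), mul_one]
    rw [e] at h
    have e2 : σ y - 1 = ∫ t in (0 : ℝ)..y, (σ t - 1) := by
      rw [intervalIntegral.integral_sub (hσc.intervalIntegrable _ _) intervalIntegrable_const]
      simp only [intervalIntegral.integral_const, sub_zero, Complex.real_smul, mul_one]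
      push_cast at h
      linear_combination h
    rw [e2]
    exact intervalIntegral.norm_integral_le_integral_norm hy
  refine ⟨σ, hσc, fun u _ => hσc.intervalIntegrable _ _, hinit, fun u hu => ?_⟩
  rcases le_total u 1 with h1 | h1
  · have h := main u hu
    rw [max_eq_right h1, max_eq_left (by linarith : (0:ℝ) ≤ 1 - u), hinit u hu h1] at h
    rw [hinit u hu h1]
    push_cast at h
    linear_combination h
  · have h := main u hu
    rw [max_eq_left h1, max_eq_right (by linarith : 1 - u ≤ 0)] at h
    simpa using h

/-! ### The entire exponential integral and Euler's constant -/

/-- The entire exponential integral `Ein x = ∫₀ˣ (1 - e^{-t}) / t dt`. -/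
noncomputable def ein (x : ℝ) : ℝ := ∫ t in (0 : ℝ)..x, (1 - Real.exp (-t)) / t

theorem one_sub_exp_neg_div_le_one {t : ℝ} (ht : 0 ≤ t) : (1 - Real.exp (-t)) / t ≤ 1 := by
  rcases ht.eq_or_lt with rfl | h
  · simp
  · rw [div_le_one h]; linarith [Real.add_one_le_exp (-t)]

theorem one_sub_exp_neg_div_nonneg {t : ℝ} (ht : 0 ≤ t) : 0 ≤ (1 - Real.exp (-t)) / t :=
  div_nonneg (by simpa using ht) ht

theorem intervalIntegrable_one_sub_exp_neg_div {a b : ℝ} (ha : 0 ≤ a) (hb : 0 ≤ b) :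
    IntervalIntegrable (fun t => (1 - Real.exp (-t)) / t) volume a b := by
  refine (intervalIntegrable_const (c := (1:ℝ))).mono_fun
    (Measurable.aestronglyMeasurable (by fun_prop)) ?_
  filter_upwards [ae_restrict_mem measurableSet_uIoc] with t ht
  have h0 : 0 ≤ t := (le_min ha hb).trans ht.1.le
  rw [Real.norm_of_nonneg (one_sub_exp_neg_div_nonneg h0)]
  simpa using one_sub_exp_neg_div_le_one h0

theorem ein_nonneg {x : ℝ} (hx : 0 ≤ x) : 0 ≤ ein x :=
  intervalIntegral.integral_nonneg hx fun _ ht => one_sub_exp_neg_div_nonneg ht.1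

theorem ein_le_self {x : ℝ} (hx : 0 ≤ x) : ein x ≤ x := by
  have := intervalIntegral.integral_mono_on (μ := volume) hx
    (intervalIntegrable_one_sub_exp_neg_div le_rfl hx)
    (intervalIntegrable_const (c := (1:ℝ))) fun t ht => one_sub_exp_neg_div_le_one ht.1
  simpa [ein] using this

theorem hasDerivAt_ein {x : ℝ} (hx : 0 < x) : HasDerivAt ein ((1 - Real.exp (-x)) / x) x := by
  refine intervalIntegral.integral_hasDerivAt_right
    (intervalIntegrable_one_sub_exp_neg_div le_rfl hx.le) ?_ ?_
  · exact (Measurable.stronglyMeasurable (by fun_prop)).stronglyMeasurableAtFilter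
  · exact ContinuousAt.div (by fun_prop) (by fun_prop) hx.ne'

/-- `Γ'(1) = -γ` in integral form. -/
theorem integral_log_mul_exp_neg :
    ∫ t in Ioi (0:ℝ), Real.log t * Real.exp (-t) = - Real.eulerMascheroniConstant := by
  have h1 := Complex.hasDerivAt_GammaIntegral (s := 1) (by simp)
  have h2 : HasDerivAt Complex.GammaIntegral (-Real.eulerMascheroniConstant : ℂ) 1 := by
    refine Complex.hasDerivAt_Gamma_one.congr_of_eventuallyEq ?_
    have : IsOpen {s : ℂ | 0 < s.re} := Complex.continuous_re.isOpen_preimage _ isOpen_Ioi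
    filter_upwards [this.mem_nhds (show (1:ℂ) ∈ {s : ℂ | 0 < s.re} by simp)] with a ha
    exact (Complex.Gamma_eq_integral ha).symm
  have h3 := h1.unique h2
  simp only [sub_self, Complex.cpow_zero, one_mul, ← Complex.ofReal_mul] at h3
  rw [integral_complex_ofReal] at h3
  exact_mod_cast h3

theorem integrableOn_log_mul_exp_neg :
    IntegrableOn (fun t : ℝ => Real.log t * Real.exp (-t)) (Ioi 0) := by
  -- A non-integrable function would have integral `0 ≠ -γ`.
  by_contra h
  have := integral_log_mul_exp_neg
  rw [integral_undef h] at this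
  linarith [Real.one_half_lt_eulerMascheroniConstant]

/-- Integration by parts in `Ein`, checked by differentiating and letting `x → 0`. -/
theorem ein_eq {x : ℝ} (hx : 0 < x) :
    ein x = (1 - Real.exp (-x)) * Real.log x
      - ∫ t in (0 : ℝ)..x, Real.log t * Real.exp (-t) := by
  have hii : ∀ {y : ℝ}, 0 ≤ y →
      IntervalIntegrable (fun t : ℝ => Real.log t * Real.exp (-t)) volume 0 y := fun hy =>
    (intervalIntegrable_iff_integrableOn_Ioc_of_le hy).2
      (integrableOn_log_mul_exp_neg.mono_set Ioc_subset_Ioi_self)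
  set h : ℝ → ℝ := fun y => ein y - (1 - Real.exp (-y)) * Real.log y
    + ∫ t in (0 : ℝ)..y, Real.log t * Real.exp (-t) with hh
  have hd : ∀ y ∈ Ioi (0:ℝ), HasDerivAt h 0 y := fun y hy => by
    have hy' : y ≠ 0 := ne_of_gt hy
    have h3 : HasDerivAt (fun y => ∫ t in (0 : ℝ)..y, Real.log t * Real.exp (-t))
        (Real.log y * Real.exp (-y)) y :=
      intervalIntegral.integral_hasDerivAt_right (hii (le_of_lt hy))
        (Measurable.stronglyMeasurable (by fun_prop)).stronglyMeasurableAtFilter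
        (ContinuousAt.mul (Real.continuousAt_log hy') (by fun_prop))
    have := ((hasDerivAt_ein hy).sub
      (((hasDerivAt_neg y).exp.const_sub 1).mul (Real.hasDerivAt_log hy'))).add h3
    refine this.congr_deriv ?_
    field_simp
    ring
  have hconst : ∀ y ∈ Ioi (0:ℝ), h y = h x := fun y hy =>
    isOpen_Ioi.is_const_of_deriv_eq_zero isPreconnected_Ioi
      (fun z hz => (hd z hz).differentiableAt.differentiableWithinAt)
      (fun z hz => (hd z hz).deriv) hy hx
  have hlim : Tendsto h (𝓝[>] 0) (𝓝 (0 - 0 + 0)) := by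
    refine (Tendsto.sub ?_ ?_).add ?_
    · refine squeeze_zero' (g := fun y => y) ?_ ?_ (tendsto_nhdsWithin_of_tendsto_nhds tendsto_id)
      · filter_upwards [self_mem_nhdsWithin] with y hy
        exact intervalIntegral.integral_nonneg (le_of_lt hy)
          fun t ht => one_sub_exp_neg_div_nonneg ht.1
      · filter_upwards [self_mem_nhdsWithin] with y hy using ein_le_self (le_of_lt hy)
    · refine squeeze_zero_norm' (a := fun y : ℝ => ‖Real.log y * y‖) ?_ ?_
      · filter_upwards [self_mem_nhdsWithin] with y hy
        rw [norm_mul, norm_mul, mul_comm]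
        refine mul_le_mul_of_nonneg_left ?_ (norm_nonneg _)
        have hy0 : (0:ℝ) < y := hy
        rw [Real.norm_of_nonneg (by simpa using hy0.le), Real.norm_of_nonneg hy0.le]
        linarith [Real.add_one_le_exp (-y)]
      · have := (tendsto_log_mul_rpow_nhdsGT_zero one_pos).norm
        simpa using this
    · have hc : ContinuousOn (fun y => ∫ t in (0 : ℝ)..y, Real.log t * Real.exp (-t))
          (uIcc 0 1) := intervalIntegral.continuousOn_primitive_interval' (hii zero_le_one)
        (by simp)
      have := (hc 0 (by simp)).mono_left (nhdsWithin_le_of_mem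
        (show uIcc (0:ℝ) 1 ∈ 𝓝[>] 0 from by
          rw [uIcc_of_le zero_le_one]; exact Icc_mem_nhdsGT one_pos))
      simpa using this
  have hx0 : h x = 0 := by
    have : Tendsto h (𝓝[>] 0) (𝓝 (h x)) := tendsto_const_nhds.congr' (by
      filter_upwards [self_mem_nhdsWithin] with y hy using (hconst y hy).symm)
    simpa using tendsto_nhds_unique this hlim
  simp only [hh] at hx0
  linarith

/-- `Ein x - log x` tends to Euler's constant. -/
theorem tendsto_ein_sub_log :
    Tendsto (fun x => ein x - Real.log x) atTop (𝓝 Real.eulerMascheroniConstant) := by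
  have h1 : Tendsto (fun x : ℝ => ∫ t in (0 : ℝ)..x, Real.log t * Real.exp (-t)) atTop
      (𝓝 (-Real.eulerMascheroniConstant)) := by
    rw [← integral_log_mul_exp_neg]
    exact intervalIntegral_tendsto_integral_Ioi 0 integrableOn_log_mul_exp_neg tendsto_id
  have h2 : Tendsto (fun x : ℝ => Real.exp (-x) * Real.log x) atTop (𝓝 0) := by
    refine squeeze_zero_norm' (a := fun x : ℝ => x * Real.exp (-x)) ?_ ?_
    · filter_upwards [eventually_ge_atTop 1] with x hx
      rw [norm_mul, mul_comm, Real.norm_of_nonneg (Real.log_nonneg hx),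
        Real.norm_of_nonneg (Real.exp_pos _).le]
      exact mul_le_mul_of_nonneg_right
        (by linarith [Real.log_le_sub_one_of_pos (by linarith : 0 < x)])
        (Real.exp_pos _).le
    · simpa using Real.tendsto_pow_mul_exp_neg_atTop_nhds_zero 1
  have h3 := (h2.neg).sub h1
  simp only [neg_zero, zero_sub, neg_neg] at h3
  refine h3.congr' ?_
  filter_upwards [eventually_gt_atTop 0] with x hx
  rw [ein_eq hx]
  ring

/-- The difference of the two sides is monotone in `x` and tends to `0` as `x → ∞`. -/
theorem ein_le {x : ℝ} (hx : 0 < x) :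
    ein x ≤ Real.log x + Real.eulerMascheroniConstant + Real.exp (-x) / x := by
  have hmono : MonotoneOn (fun y => ein y - Real.log y - Real.exp (-y) / y) (Ioi 0) := by
    have hd : ∀ y ∈ Ioi (0:ℝ), HasDerivAt (fun y => ein y - Real.log y - Real.exp (-y) / y)
        (Real.exp (-y) / y ^ 2) y := fun y hy => by
      have hy' : y ≠ 0 := (ne_of_gt hy)
      have := ((hasDerivAt_ein hy).sub (Real.hasDerivAt_log hy')).sub
        ((hasDerivAt_neg y).exp.div (hasDerivAt_id y) hy')
      refine this.congr_deriv ?_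
      simp only [id]
      field_simp
      ring
    refine monotoneOn_of_deriv_nonneg (convex_Ioi 0)
      (fun y hy => (hd y hy).continuousAt.continuousWithinAt)
      (fun y hy => (hd y (interior_subset hy)).differentiableAt.differentiableWithinAt)
      fun y hy => ?_
    rw [(hd y (interior_subset hy)).deriv]
    positivity
  have hlim : Tendsto (fun y => ein y - Real.log y - Real.exp (-y) / y) atTop
      (𝓝 (Real.eulerMascheroniConstant - 0)) := by
    refine tendsto_ein_sub_log.sub ?_
    simpa [div_eq_mul_inv] using
      (Real.tendsto_exp_neg_atTop_nhds_zero).mul tendsto_inv_atTop_zero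
  have := ge_of_tendsto hlim (b := ein x - Real.log x - Real.exp (-x) / x) <| by
    filter_upwards [eventually_ge_atTop x] with y hy
    exact hmono hx (hx.trans_le hy) hy
  linarith

/-! ### Plancherel's theorem for functions in `L¹ ∩ L²` -/

open scoped FourierTransform SchwartzMap ENNReal in
/-- The `L²` Fourier transform of an integrable, square integrable function is given by the
Fourier integral. -/
theorem coeFn_fourier_toLp_ae_eq {f : ℝ → ℂ} (hf : Integrable f) (hf2 : MemLp f 2) :
    ((𝓕 (hf2.toLp f) : Lp ℂ 2) : ℝ → ℂ) =ᵐ[volume] 𝓕 f := by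
  have hFc : Continuous (𝓕 f) :=
    VectorFourier.fourierIntegral_continuous Real.continuous_fourierChar
      (innerSL ℝ).continuous₂ hf
  refine ae_eq_of_integral_contDiff_smul_eq
    ((Lp.memLp _).locallyIntegrable (by norm_num)) hFc.locallyIntegrable ?_
  intro g hg hgs
  set φ : 𝓢(ℝ, ℂ) := HasCompactSupport.toSchwartzMap (f := fun x => (g x : ℂ))
    (hgs.comp_left Complex.ofReal_zero) (Complex.ofRealCLM.contDiff.comp hg) with hφ
  have hφa : ∀ x, φ x = (g x : ℂ) := fun x => rfl
  have h1 := congrArg (fun T => T φ) (Lp.fourier_toTemperedDistribution_eq (hf2.toLp f))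
  simp only [TemperedDistribution.fourier_apply, Lp.toTemperedDistribution_apply] at h1
  have h2 : ∫ x, (𝓕 φ) x • (hf2.toLp f : ℝ → ℂ) x = ∫ x, (𝓕 φ) x • f x := by
    refine integral_congr_ae ?_
    filter_upwards [hf2.coeFn_toLp] with x hx
    rw [hx]
  have h3 := VectorFourier.integral_fourierIntegral_smul_eq_flip (μ := volume) (ν := volume)
    (f := (φ : ℝ → ℂ)) (g := f) (L := innerₗ ℝ) Real.continuous_fourierChar
    (innerSL ℝ).continuous₂ φ.integrable hf
  rw [flip_innerₗ] at h3
  rw [h2] at h1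
  simp only [SchwartzMap.fourier_coe] at h1
  have h4 : ∫ x, φ x • ((𝓕 (hf2.toLp f) : Lp ℂ 2 (volume : Measure ℝ)) : ℝ → ℂ) x =
      ∫ x, φ x • 𝓕 f x :=
    h1.symm.trans h3
  simpa [hφa] using h4

open scoped FourierTransform in
/-- Plancherel's theorem for the Fourier integral on `L¹ ∩ L²`. -/
theorem eLpNorm_fourier_eq {f : ℝ → ℂ} (hf : Integrable f) (hf2 : MemLp f 2) :
    eLpNorm (𝓕 f) 2 volume = eLpNorm f 2 volume := by
  rw [← eLpNorm_congr_ae (coeFn_fourier_toLp_ae_eq hf hf2), ← eLpNorm_congr_ae hf2.coeFn_toLp]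
  have := Lp.norm_fourier_eq (hf2.toLp f)
  rw [Lp.norm_def, Lp.norm_def] at this
  exact (ENNReal.toReal_eq_toReal_iff' (Lp.eLpNorm_ne_top _) (Lp.eLpNorm_ne_top _)).1 this

open scoped FourierTransform Convolution in
/-- Convolution with `a` is bounded on `L²` by the supremum of the Fourier transform of `a`. -/
theorem eLpNorm_convolution_le {a b c : ℝ → ℂ} {B : ℝ} (ha : Integrable a) (hb : Integrable b)
    (hb2 : MemLp b 2) (hc2 : MemLp c 2)
    (hc : ∀ x, c x = (a ⋆[ContinuousLinearMap.mul ℂ ℂ] b) x) (hB : ∀ ξ, ‖𝓕 a ξ‖ ≤ B) :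
    eLpNorm c 2 volume ≤ ENNReal.ofReal B * eLpNorm b 2 volume := by
  have hc' : c = a ⋆[ContinuousLinearMap.mul ℂ ℂ] b := funext hc
  have hci : Integrable c := hc' ▸ ha.integrable_convolution _ hb
  rw [← eLpNorm_fourier_eq hci hc2, ← eLpNorm_fourier_eq hb hb2]
  refine eLpNorm_le_mul_eLpNorm_of_ae_le_mul (Eventually.of_forall fun ξ => ?_) 2
  rw [hc', Real.fourier_mul_convolution_eq ha hb, norm_mul]
  exact mul_le_mul_of_nonneg_right (hB ξ) (norm_nonneg _)

/-! ### Laplace transforms of bounded functions on the half-line -/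

/-- Measurable functions on `ℝ` that are bounded by `1` and vanish on the negative half-line. -/
structure IsCausal (f : ℝ → ℂ) : Prop where
  meas : AEStronglyMeasurable f volume
  norm_le : ∀ t, ‖f t‖ ≤ 1
  eq_zero : ∀ t < 0, f t = 0

/-- The Laplace transform `∫ e^{-zt} f(t) dt`, as an integral over the whole line. -/
noncomputable def laplace (f : ℝ → ℂ) (z : ℂ) : ℂ := ∫ t : ℝ, Complex.exp (-(z * t)) * f t

/-- The dominating function `e^{-ct}` on `[0, ∞)`. -/
noncomputable def expDecay (c : ℝ) : ℝ → ℝ := (Ici (0:ℝ)).indicator fun t => Real.exp (-c * t)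

theorem integrable_expDecay {c : ℝ} (hc : 0 < c) : Integrable (expDecay c) := by
  rw [expDecay, integrable_indicator_iff measurableSet_Ici, integrableOn_Ici_iff_integrableOn_Ioi]
  exact integrableOn_exp_mul_Ioi (neg_lt_zero.2 hc) 0

theorem integral_expDecay {c : ℝ} (hc : 0 < c) : ∫ t, expDecay c t = 1 / c := by
  rw [expDecay, integral_indicator measurableSet_Ici, integral_Ici_eq_integral_Ioi,
    integral_exp_mul_Ioi (neg_lt_zero.2 hc)]
  simp [neg_div_neg_eq]

theorem norm_exp_neg_mul (z : ℂ) (t : ℝ) :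
    ‖Complex.exp (-(z * t))‖ = Real.exp (-z.re * t) := by
  rw [Complex.norm_exp]; simp

theorem IsCausal.norm_exp_mul_le {f : ℝ → ℂ} (hf : IsCausal f) {z : ℂ} {c : ℝ} (hc : c ≤ z.re)
    (t : ℝ) : ‖Complex.exp (-(z * t)) * f t‖ ≤ expDecay c t := by
  by_cases ht : t ∈ Ici (0:ℝ)
  · rw [expDecay, indicator_of_mem ht, norm_mul, norm_exp_neg_mul]
    refine (mul_le_of_le_one_right (Real.exp_pos _).le (hf.norm_le t)).trans
      (Real.exp_le_exp.2 ?_)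
    have : (0:ℝ) ≤ t := ht
    nlinarith
  · rw [expDecay, indicator_of_notMem ht, hf.eq_zero t (by simpa using ht)]; simp

theorem mul_exp_neg_le {c : ℝ} (hc : 0 < c) (t : ℝ) :
    t * Real.exp (-c * t) ≤ 2 / c * Real.exp (-(c / 2) * t) := by
  have h1 : -c * t = -(c / 2) * t + -(c / 2) * t := by ring
  have h2 := Real.add_one_le_exp (c / 2 * t)
  have h3 : Real.exp (c / 2 * t) * Real.exp (-(c / 2) * t) = 1 := by
    rw [← Real.exp_add]; simp
  have h4 := Real.exp_pos (-(c / 2) * t)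
  rw [h1, Real.exp_add, ← mul_assoc]
  refine mul_le_mul_of_nonneg_right ?_ h4.le
  have h5 : c / 2 * t * Real.exp (-(c / 2) * t) ≤ 1 := by
    rw [← h3]; exact mul_le_mul_of_nonneg_right (by linarith) h4.le
  rw [le_div_iff₀ hc]
  linarith

theorem IsCausal.norm_mul_exp_mul_le {f : ℝ → ℂ} (hf : IsCausal f) {z : ℂ} {c : ℝ} (hc0 : 0 < c)
    (hc : c ≤ z.re) (t : ℝ) :
    ‖(t : ℂ) * (Complex.exp (-(z * t)) * f t)‖ ≤ 2 / c * expDecay (c / 2) t := by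
  rw [norm_mul, Complex.norm_real]
  refine (mul_le_mul_of_nonneg_left (hf.norm_exp_mul_le hc t) (norm_nonneg _)).trans ?_
  by_cases ht : t ∈ Ici (0:ℝ)
  · rw [expDecay, expDecay, indicator_of_mem ht, indicator_of_mem ht, Real.norm_of_nonneg ht]
    exact mul_exp_neg_le hc0 t
  · rw [expDecay, expDecay, indicator_of_notMem ht, indicator_of_notMem ht]; simp

theorem IsCausal.aestronglyMeasurable_exp_mul {f : ℝ → ℂ} (hf : IsCausal f) (z : ℂ) :
    AEStronglyMeasurable (fun t : ℝ => Complex.exp (-(z * t)) * f t) volume :=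
  (by fun_prop : Continuous fun t : ℝ => Complex.exp (-(z * t))).aestronglyMeasurable.mul hf.meas

theorem IsCausal.aestronglyMeasurable_mul_exp_mul {f : ℝ → ℂ} (hf : IsCausal f) (z : ℂ) :
    AEStronglyMeasurable (fun t : ℝ => (t : ℂ) * (Complex.exp (-(z * t)) * f t)) volume :=
  (by fun_prop : Continuous fun t : ℝ => (t : ℂ)).aestronglyMeasurable.mul
    (hf.aestronglyMeasurable_exp_mul z)

theorem IsCausal.integrable_exp_mul {f : ℝ → ℂ} (hf : IsCausal f) {z : ℂ} (hz : 0 < z.re) :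
    Integrable (fun t : ℝ => Complex.exp (-(z * t)) * f t) :=
  (integrable_expDecay hz).mono' (hf.aestronglyMeasurable_exp_mul z)
    (Eventually.of_forall fun t => hf.norm_exp_mul_le le_rfl t)

theorem IsCausal.norm_laplace_le {f : ℝ → ℂ} (hf : IsCausal f) {z : ℂ} (hz : 0 < z.re) :
    ‖laplace f z‖ ≤ 1 / z.re := by
  rw [← integral_expDecay hz]
  exact norm_integral_le_of_norm_le (integrable_expDecay hz)
    (Eventually.of_forall fun t => hf.norm_exp_mul_le le_rfl t)

theorem IsCausal.hasDerivAt_laplace {f : ℝ → ℂ} (hf : IsCausal f) {z : ℂ} (hz : 0 < z.re) :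
    HasDerivAt (laplace f) (-∫ t : ℝ, (t : ℂ) * (Complex.exp (-(z * t)) * f t)) z := by
  have hz2 : 0 < z.re / 2 := by linarith
  have hs : {w : ℂ | z.re / 2 < w.re} ∈ 𝓝 z :=
    (isOpen_lt continuous_const Complex.continuous_re).mem_nhds (by simp; linarith)
  have := hasDerivAt_integral_of_dominated_loc_of_deriv_le (𝕜 := ℂ) (μ := volume) hs
    (F := fun w (t : ℝ) => Complex.exp (-(w * t)) * f t) (x₀ := z)
    (F' := fun w (t : ℝ) => -((t : ℂ) * (Complex.exp (-(w * t)) * f t)))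
    (bound := fun t => 2 / (z.re / 2) * expDecay (z.re / 2 / 2) t)
    (Eventually.of_forall fun w => hf.aestronglyMeasurable_exp_mul w) (hf.integrable_exp_mul hz)
    (hf.aestronglyMeasurable_mul_exp_mul z).neg
    (Eventually.of_forall fun t w hw => by
      rw [norm_neg]; exact hf.norm_mul_exp_mul_le hz2 (le_of_lt hw) t)
    ((integrable_expDecay (by linarith)).const_mul _)
    (Eventually.of_forall fun t w _ => by
      have := (((hasDerivAt_id w).mul_const (t : ℂ)).neg.cexp.mul_const (f t))
      refine this.congr_deriv ?_
      simp only [id, Pi.neg_apply]; ring)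
  rw [← integral_neg]
  exact this.2

/-! ### The logarithm of the Laplace transform -/

/-- `∫₀ᵘ (1 - χ(v) e^{-zv}) / v dv`; its real part on the imaginary axis is `twistedDistance`. -/
noncomputable def logFactor (χ : ℝ → ℂ) (u : ℝ) (z : ℂ) : ℂ :=
  ∫ v in (0 : ℝ)..u, (1 - χ v * Complex.exp (-(z * v))) / v

/-- The integrand of `logFactor` is bounded on `(0, u]`: near `0` because `χ = 1` there. -/
theorem IsUnitKernel.norm_logFactor_integrand_le {χ : ℝ → ℂ} (hχ : IsUnitKernel χ) {u : ℝ}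
    (z : ℂ) {v : ℝ} (hv : v ∈ Ioc 0 u) :
    ‖(1 - χ v * Complex.exp (-(z * v))) / v‖ ≤
      ‖z‖ * Real.exp ‖z‖ + (1 + Real.exp (‖z‖ * u)) := by
  have hv0 : 0 < v := hv.1
  rw [norm_div, Complex.norm_real, Real.norm_of_nonneg hv0.le, div_le_iff₀ hv0]
  rcases le_total v 1 with h1 | h1
  · rw [hχ.eq_one v hv0.le h1, one_mul, norm_sub_rev]
    have h := Complex.norm_exp_sub_sum_le_norm_mul_exp (-(z * v)) 1
    simp only [Finset.range_one, Finset.sum_singleton, pow_zero, Nat.factorial_zero, Nat.cast_one,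
      div_one, norm_neg, norm_mul, Complex.norm_real, Real.norm_of_nonneg hv0.le, pow_one] at h
    have h2 : Real.exp (‖z‖ * v) ≤ Real.exp ‖z‖ :=
      Real.exp_le_exp.2 (mul_le_of_le_one_right (norm_nonneg _) h1)
    have h3 : ‖z‖ * v * Real.exp (‖z‖ * v) ≤ ‖z‖ * v * Real.exp ‖z‖ :=
      mul_le_mul_of_nonneg_left h2 (by positivity)
    have h4 : 0 ≤ (1 + Real.exp (‖z‖ * u)) * v := by positivity
    nlinarith
  · have h2 : ‖Complex.exp (-(z * v))‖ ≤ Real.exp (‖z‖ * u) := by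
      refine (Complex.norm_exp_le_exp_norm _).trans (Real.exp_le_exp.2 ?_)
      rw [norm_neg, norm_mul, Complex.norm_real, Real.norm_of_nonneg hv0.le]
      exact mul_le_mul_of_nonneg_left hv.2 (norm_nonneg _)
    have h3 : ‖1 - χ v * Complex.exp (-(z * v))‖ ≤ 1 + Real.exp (‖z‖ * u) := by
      refine (norm_sub_le _ _).trans ?_
      rw [norm_one, norm_mul]
      have := mul_le_mul (hχ.norm_le v hv0.le) h2 (norm_nonneg _) zero_le_one
      linarith
    have h4 : 0 ≤ ‖z‖ * Real.exp ‖z‖ * v := by positivity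
    have h5 : 0 ≤ Real.exp (‖z‖ * u) := (Real.exp_pos _).le
    nlinarith

theorem IsUnitKernel.aestronglyMeasurable_Ioc {χ : ℝ → ℂ} (hχ : IsUnitKernel χ) {a b : ℝ}
    (ha : 0 ≤ a) : AEStronglyMeasurable χ (volume.restrict (Ioc a b)) :=
  hχ.measurable.aestronglyMeasurable.mono_measure
    (Measure.restrict_mono (fun _ ht => ha.trans (le_of_lt ht.1)) le_rfl)

theorem IsUnitKernel.aestronglyMeasurable_logFactor_integrand {χ : ℝ → ℂ} (hχ : IsUnitKernel χ)
    (u : ℝ) (z : ℂ) : AEStronglyMeasurable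
      (fun v : ℝ => (1 - χ v * Complex.exp (-(z * v))) / v) (volume.restrict (Ioc 0 u)) := by
  have h1 := (hχ.aestronglyMeasurable_Ioc (b := u) le_rfl).mul
    (by fun_prop : Continuous fun v : ℝ => Complex.exp (-(z * v))).aestronglyMeasurable.restrict
  have h2 : AEStronglyMeasurable (fun v : ℝ => ((v : ℂ))⁻¹) (volume.restrict (Ioc 0 u)) :=
    (Measurable.aestronglyMeasurable (by fun_prop))
  simp only [div_eq_mul_inv]
  exact (aestronglyMeasurable_const.sub h1).mul h2

theorem IsUnitKernel.intervalIntegrable_logFactor {χ : ℝ → ℂ} (hχ : IsUnitKernel χ) {u : ℝ}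
    (hu : 0 ≤ u) (z : ℂ) :
    IntervalIntegrable (fun v : ℝ => (1 - χ v * Complex.exp (-(z * v))) / v) volume 0 u := by
  rw [intervalIntegrable_iff_integrableOn_Ioc_of_le hu]
  refine Integrable.mono' (integrableOn_const (C := ‖z‖ * Real.exp ‖z‖ + (1 + Real.exp (‖z‖ * u)))
    (by simp)) (hχ.aestronglyMeasurable_logFactor_integrand u z) ?_
  filter_upwards [ae_restrict_mem measurableSet_Ioc] with v hv
  exact hχ.norm_logFactor_integrand_le z hv

theorem IsUnitKernel.hasDerivAt_logFactor {χ : ℝ → ℂ} (hχ : IsUnitKernel χ) {u : ℝ}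
    (hu : 0 ≤ u) (z : ℂ) :
    HasDerivAt (logFactor χ u) (∫ v in (0 : ℝ)..u, χ v * Complex.exp (-(z * v))) z := by
  refine (intervalIntegral.hasDerivAt_integral_of_dominated_loc_of_deriv_le (𝕜 := ℂ)
    (Metric.ball_mem_nhds z one_pos)
    (F := fun w (v : ℝ) => (1 - χ v * Complex.exp (-(w * v))) / v)
    (F' := fun w (v : ℝ) => χ v * Complex.exp (-(w * v)))
    (bound := fun _ => Real.exp ((‖z‖ + 1) * u)) ?_ (hχ.intervalIntegrable_logFactor hu z) ?_ ?_
    intervalIntegrable_const ?_).2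
  · rw [uIoc_of_le hu]
    exact Eventually.of_forall fun w => hχ.aestronglyMeasurable_logFactor_integrand u w
  · rw [uIoc_of_le hu]
    exact (hχ.aestronglyMeasurable_Ioc (b := u) le_rfl).mul
      (by fun_prop : Continuous fun v : ℝ => Complex.exp (-(z * v))).aestronglyMeasurable.restrict
  · refine Eventually.of_forall fun v hv w hw => ?_
    rw [uIoc_of_le hu] at hv
    rw [norm_mul]
    refine (mul_le_of_le_one_left (norm_nonneg _) (hχ.norm_le v hv.1.le)).trans
      ((Complex.norm_exp_le_exp_norm _).trans (Real.exp_le_exp.2 ?_))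
    rw [norm_neg, norm_mul, Complex.norm_real, Real.norm_of_nonneg hv.1.le]
    refine mul_le_mul ?_ hv.2 hv.1.le (by positivity)
    have := norm_le_norm_add_norm_sub' w z
    rw [mem_ball_iff_norm] at hw
    linarith
  · refine Eventually.of_forall fun v hv w _ => ?_
    rw [uIoc_of_le hu] at hv
    have hv0 : (v : ℂ) ≠ 0 := by exact_mod_cast hv.1.ne'
    have := (((((hasDerivAt_id w).mul_const (v : ℂ)).neg.cexp.const_mul (χ v)).const_sub 1).div_const
      (v : ℂ))
    refine this.congr_deriv ?_
    simp only [id, Pi.neg_apply]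
    field_simp

theorem IsUnitKernel.re_logFactor {χ : ℝ → ℂ} (hχ : IsUnitKernel χ) {u : ℝ}
    (hu : 0 ≤ u) (z : ℂ) : (logFactor χ u z).re =
      ∫ v in (0 : ℝ)..u, (1 - (χ v * Complex.exp (-(z * v))).re) / v := by
  have := Complex.reCLM.intervalIntegral_comp_comm (hχ.intervalIntegrable_logFactor hu z)
  simp only [Complex.reCLM_apply] at this
  rw [logFactor, ← this]
  refine intervalIntegral.integral_congr fun v _ => ?_
  simp only [Complex.div_ofReal_re, Complex.sub_re, Complex.one_re]

theorem IsUnitKernel.intervalIntegrable_re_logFactor {χ : ℝ → ℂ} (hχ : IsUnitKernel χ) {u : ℝ}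
    (hu : 0 ≤ u) (z : ℂ) : IntervalIntegrable
      (fun v => (1 - (χ v * Complex.exp (-(z * v))).re) / v) volume 0 u := by
  have h := hχ.intervalIntegrable_logFactor hu z
  have h2 : IntervalIntegrable
      (fun v : ℝ => ((1 - χ v * Complex.exp (-(z * v))) / (v:ℂ)).re) volume 0 u :=
    ⟨Integrable.re h.1, Integrable.re h.2⟩
  simpa only [Complex.div_ofReal_re, Complex.sub_re, Complex.one_re] using h2

theorem IsUnitKernel.re_logFactor_integrand_nonneg {χ : ℝ → ℂ} (hχ : IsUnitKernel χ) {z : ℂ}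
    (hz : 0 ≤ z.re) {v : ℝ} (hv : 0 ≤ v) :
    0 ≤ (1 - (χ v * Complex.exp (-(z * v))).re) / v := by
  refine div_nonneg (sub_nonneg.2 ((Complex.re_le_norm _).trans ?_)) hv
  rw [norm_mul, norm_exp_neg_mul]
  refine mul_le_one₀ (hχ.norm_le v hv) (Real.exp_pos _).le (Real.exp_le_one_iff.2 ?_)
  nlinarith

theorem IsUnitKernel.re_logFactor_nonneg {χ : ℝ → ℂ} (hχ : IsUnitKernel χ) {u : ℝ}
    (hu : 0 ≤ u) {z : ℂ} (hz : 0 ≤ z.re) : 0 ≤ (logFactor χ u z).re := by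
  rw [hχ.re_logFactor hu]
  exact intervalIntegral.integral_nonneg hu
    fun v hv => hχ.re_logFactor_integrand_nonneg hz hv.1

theorem IsUnitKernel.twistedDistance_eq {χ : ℝ → ℂ} (hχ : IsUnitKernel χ) {u : ℝ}
    (hu : 0 ≤ u) (y : ℝ) : twistedDistance χ u y = (logFactor χ u (y * Complex.I)).re := by
  rw [hχ.re_logFactor hu, twistedDistance]
  refine intervalIntegral.integral_congr fun v _ => ?_
  rw [show Complex.I * v * y = y * Complex.I * v by ring]

/-! ### Kernels of bounded support -/

/-- `k` is a kernel supported on `[0, u]`, and `s` is the corresponding solution; both are extended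
by `0` to the negative half-line, so that the equation becomes a convolution on the line. -/
structure IsTruncatedPair (u : ℝ) (k s : ℝ → ℂ) : Prop where
  one_le : 1 ≤ u
  kernel : IsUnitKernel k
  causal_k : IsCausal k
  causal_s : IsCausal s
  k_eq_zero : ∀ t, u < t → k t = 0
  s_eq_one : ∀ t, 0 ≤ t → t ≤ 1 → s t = 1
  equation : ∀ t : ℝ, (t : ℂ) * s t = ∫ x, s x * k (t - x)

theorem IsUnitKernel.isCausal_indicator {χ : ℝ → ℂ} (hχ : IsUnitKernel χ) :
    IsCausal ((Ici (0:ℝ)).indicator χ) where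
  meas := (aestronglyMeasurable_indicator_iff measurableSet_Ici).2
    hχ.measurable.aestronglyMeasurable
  norm_le t := by
    by_cases h : t ∈ Ici (0:ℝ)
    · rw [indicator_of_mem h]; exact hχ.norm_le t h
    · rw [indicator_of_notMem h]; simp
  eq_zero t ht := indicator_of_notMem (by simpa using ht) _

theorem IsSolution.isCausal_indicator {χ σ : ℝ → ℂ} (hχ : IsUnitKernel χ) (hσ : IsSolution χ σ) :
    IsCausal ((Ici (0:ℝ)).indicator σ) where
  meas := by
    rw [aestronglyMeasurable_indicator_iff measurableSet_Ici, ← restrict_Ioi_eq_restrict_Ici]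
    have : Ioi (0:ℝ) = ⋃ n : ℕ, Ioc (0:ℝ) n := by
      ext x
      simp only [mem_Ioi, mem_iUnion, mem_Ioc]
      exact ⟨fun h => (exists_nat_ge x).imp fun n hn => ⟨h, hn⟩, fun ⟨n, hn⟩ => hn.1⟩
    rw [this, aestronglyMeasurable_iUnion_iff]
    intro n
    have := hσ.integrable n (by positivity)
    rw [intervalIntegrable_iff_integrableOn_Ioc_of_le (by positivity)] at this
    exact this.aestronglyMeasurable
  norm_le t := by
    by_cases h : t ∈ Ici (0:ℝ)
    · rw [indicator_of_mem h]; exact hσ.norm_le_one hχ h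
    · rw [indicator_of_notMem h]; simp
  eq_zero t ht := indicator_of_notMem (by simpa using ht) _

theorem IsSolution.isTruncatedPair {χ σ : ℝ → ℂ} (hχ : IsUnitKernel χ) (hσ : IsSolution χ σ)
    {u : ℝ} (hu : 1 ≤ u) (h : ∀ t, u < t → χ t = 0) :
    IsTruncatedPair u ((Ici (0:ℝ)).indicator χ) ((Ici (0:ℝ)).indicator σ) where
  one_le := hu
  kernel :=
    { measurable := by
        refine hχ.measurable.congr ?_
        filter_upwards [ae_restrict_mem measurableSet_Ici] with t ht
        rw [indicator_of_mem ht]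
      norm_le := fun t _ => hχ.isCausal_indicator.norm_le t
      eq_one := fun t h0 h1 => by rw [indicator_of_mem (mem_Ici.2 h0), hχ.eq_one t h0 h1] }
  causal_k := hχ.isCausal_indicator
  causal_s := hσ.isCausal_indicator hχ
  k_eq_zero t ht := by rw [indicator_of_mem (mem_Ici.2 (by linarith)), h t ht]
  s_eq_one t h0 h1 := by rw [indicator_of_mem (mem_Ici.2 h0), hσ.initial t h0 h1]
  equation t := by
    rcases lt_or_ge t 0 with ht | ht
    · rw [indicator_of_notMem (by simpa using ht), mul_zero]
      refine (integral_eq_zero_of_ae (Eventually.of_forall fun x => ?_)).symm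
      rcases lt_or_ge x 0 with hx | hx
      · simp [indicator_of_notMem (show x ∉ Ici (0:ℝ) by simpa using hx)]
      · simp [indicator_of_notMem (show t - x ∉ Ici (0:ℝ) by simp; linarith)]
    · rw [indicator_of_mem (mem_Ici.2 ht), hσ.equation t ht,
        intervalIntegral.integral_of_le ht, ← integral_Icc_eq_integral_Ioc,
        ← integral_indicator measurableSet_Icc]
      refine integral_congr_ae (Eventually.of_forall fun x => ?_)
      by_cases hx : x ∈ Icc 0 t
      · simp only [indicator_of_mem hx, indicator_of_mem (mem_Ici.2 hx.1),
          indicator_of_mem (mem_Ici.2 (sub_nonneg.2 hx.2))]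
      · rw [indicator_of_notMem hx]
        rw [mem_Icc, not_and_or, not_le, not_le] at hx
        rcases hx with hx | hx
        · simp [indicator_of_notMem (show x ∉ Ici (0:ℝ) by simpa using hx)]
        · simp [indicator_of_notMem (show t - x ∉ Ici (0:ℝ) by simp; linarith)]

/-- The kernel `χ` cut off beyond `u`. -/
noncomputable def cutoff (u : ℝ) (χ : ℝ → ℂ) : ℝ → ℂ := (Iic u).indicator χ

theorem IsUnitKernel.cutoff {χ : ℝ → ℂ} (hχ : IsUnitKernel χ) {u : ℝ} (hu : 1 ≤ u) :
    IsUnitKernel (cutoff u χ) where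
  measurable := hχ.measurable.indicator measurableSet_Iic
  norm_le t ht := by
    by_cases h : t ∈ Iic u
    · rw [MeanValue.cutoff, indicator_of_mem h]; exact hχ.norm_le t ht
    · rw [MeanValue.cutoff, indicator_of_notMem h]; simp
  eq_one t h0 h1 := by
    rw [MeanValue.cutoff, indicator_of_mem (mem_Iic.2 (h1.trans hu)), hχ.eq_one t h0 h1]

/-- Every solution agrees on `[0, u]` with that of a truncated pair. -/
theorem IsSolution.exists_isTruncatedPair {χ σ : ℝ → ℂ} (hχ : IsUnitKernel χ)
    (hσ : IsSolution χ σ) {u : ℝ} (hu : 1 ≤ u) :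
    ∃ k s, IsTruncatedPair u k s ∧ (∀ t, 0 ≤ t → t ≤ u → k t = χ t) ∧
      ∀ t, 0 ≤ t → t ≤ u → s t = σ t := by
  obtain ⟨τ, -, hτ⟩ := (hχ.cutoff hu).exists_isSolution
  refine ⟨_, _, hτ.isTruncatedPair (hχ.cutoff hu) hu
    (fun t ht => indicator_of_notMem (by simpa using ht) _), fun t h0 h1 => ?_, fun t h0 h1 => ?_⟩
  · rw [indicator_of_mem (mem_Ici.2 h0), cutoff, indicator_of_mem (mem_Iic.2 h1)]
  · rw [indicator_of_mem (mem_Ici.2 h0)]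
    refine hτ.eq_of_eqOn (hχ.cutoff hu) hσ (U := u) (fun x _ hx => ?_) h0 h1
    rw [cutoff, indicator_of_mem (mem_Iic.2 hx.le)]

theorem logFactor_congr {χ k : ℝ → ℂ} {u : ℝ} (hu : 0 ≤ u)
    (h : ∀ t, 0 ≤ t → t ≤ u → k t = χ t) : logFactor k u = logFactor χ u := by
  ext z
  refine intervalIntegral.integral_congr fun v hv => ?_
  rw [uIcc_of_le hu] at hv
  simp only [h v hv.1 hv.2]

namespace IsTruncatedPair

variable {u : ℝ} {k s : ℝ → ℂ}

/-- The equation in terms of Laplace transforms: `t s(t)` is the convolution of `s` and `k`. -/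
theorem integral_mul_exp_mul (h : IsTruncatedPair u k s) {z : ℂ} (hz : 0 < z.re) :
    ∫ t : ℝ, (t : ℂ) * (Complex.exp (-(z * t)) * s t) = laplace s z * laplace k z := by
  have := integral_convolution (ContinuousLinearMap.mul ℂ ℂ) (μ := volume) (ν := volume)
    (h.causal_s.integrable_exp_mul hz) (h.causal_k.integrable_exp_mul hz)
  simp only [ContinuousLinearMap.mul_apply'] at this
  rw [laplace, laplace, ← this]
  refine integral_congr_ae (Eventually.of_forall fun t => ?_)
  simp only [convolution_def, ContinuousLinearMap.mul_apply']
  rw [mul_left_comm, h.equation t, ← integral_const_mul]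
  refine integral_congr_ae (Eventually.of_forall fun x => ?_)
  have : Complex.exp (-(z * t)) =
      Complex.exp (-(z * x)) * Complex.exp (-(z * ((t - x : ℝ) : ℂ))) := by
    rw [← Complex.exp_add]; push_cast; ring_nf
  simp only [this]
  ring

theorem laplace_k (h : IsTruncatedPair u k s) (z : ℂ) :
    laplace k z = ∫ v in (0 : ℝ)..u, k v * Complex.exp (-(z * v)) := by
  have hu : (0:ℝ) ≤ u := zero_le_one.trans h.one_le
  rw [laplace, intervalIntegral.integral_of_le hu, ← integral_Icc_eq_integral_Ioc,
    ← integral_indicator measurableSet_Icc]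
  refine integral_congr_ae (Eventually.of_forall fun x => ?_)
  by_cases hx : x ∈ Icc 0 u
  · simp only [indicator_of_mem hx]; ring
  · simp only [indicator_of_notMem hx]
    rw [mem_Icc, not_and_or, not_le, not_le] at hx
    rcases hx with hx | hx
    · simp [h.causal_k.eq_zero x hx]
    · simp [h.k_eq_zero x hx]

/-- As `x → ∞`, `x F(x) → 1`, because `s = 1` near `0`. -/
theorem tendsto_mul_laplace (h : IsTruncatedPair u k s) :
    Tendsto (fun x : ℝ => (x : ℂ) * laplace s x) atTop (𝓝 1) := by
  rw [tendsto_iff_norm_sub_tendsto_zero]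
  refine squeeze_zero' (g := fun x : ℝ => 2 * Real.exp (-x))
    (Eventually.of_forall fun _ => norm_nonneg _) ?_ ?_
  · filter_upwards [eventually_gt_atTop 0] with x hx
    have hxc : 0 < (x : ℂ).re := by simpa using hx
    -- Compare `s` with the indicator function of `[0, ∞)`, whose transform is `1 / x`.
    have e1 : ((1 / x : ℝ) : ℂ) = ∫ t, ((expDecay x t : ℝ) : ℂ) := by
      rw [integral_complex_ofReal, integral_expDecay hx]
    have e2 : (x : ℂ) * laplace s x - 1 =
        x * ∫ t : ℝ, (Complex.exp (-((x:ℂ) * t)) * s t - ((expDecay x t : ℝ) : ℂ)) := by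
      have hI : Integrable (fun t => ((expDecay x t : ℝ) : ℂ)) := (integrable_expDecay hx).ofReal
      rw [integral_sub (h.causal_s.integrable_exp_mul hxc) hI, ← e1, mul_sub]
      congr 1
      rw [← Complex.ofReal_mul, mul_one_div_cancel hx.ne']; simp
    have e3 : ‖∫ t : ℝ, (Complex.exp (-((x:ℂ) * t)) * s t - ((expDecay x t : ℝ) : ℂ))‖ ≤
        ∫ t, (Ioi (1:ℝ)).indicator (fun t => 2 * Real.exp (-x * t)) t := by
      refine norm_integral_le_of_norm_le ?_ (Eventually.of_forall fun t => ?_)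
      · rw [integrable_indicator_iff measurableSet_Ioi]
        exact (integrableOn_exp_mul_Ioi (neg_lt_zero.2 hx) 1).const_mul 2
      · by_cases ht : t ∈ Ioi (1:ℝ)
        · rw [indicator_of_mem ht]
          have h0 : t ∈ Ici (0:ℝ) := mem_Ici.2 (zero_le_one.trans (le_of_lt ht))
          refine (norm_sub_le _ _).trans ?_
          have h1 := h.causal_s.norm_exp_mul_le (z := x) (c := x) (by simp) t
          rw [Complex.norm_real]
          rw [expDecay, indicator_of_mem h0] at h1 ⊢
          rw [Real.norm_of_nonneg (Real.exp_pos _).le]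
          linarith
        · rw [indicator_of_notMem ht, norm_le_zero_iff, sub_eq_zero]
          by_cases h0 : t ∈ Ici (0:ℝ)
          · rw [h.s_eq_one t h0 (by simpa using ht), expDecay, indicator_of_mem h0]
            push_cast; rw [mul_one]; ring_nf
          · rw [h.causal_s.eq_zero t (by simpa using h0), expDecay, indicator_of_notMem h0]; simp
    rw [integral_indicator measurableSet_Ioi, integral_const_mul,
      integral_exp_mul_Ioi (neg_lt_zero.2 hx), mul_one, neg_div_neg_eq] at e3
    rw [e2, norm_mul, Complex.norm_real, Real.norm_of_nonneg hx.le]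
    refine (mul_le_mul_of_nonneg_left e3 hx.le).trans (le_of_eq ?_)
    field_simp
  · simpa using Real.tendsto_exp_neg_atTop_nhds_zero.const_mul 2

/-- As `x → ∞`, the logarithmic factor at `x` is `log (u x) + γ + o(1)`. -/
theorem tendsto_logFactor_sub (h : IsTruncatedPair u k s) :
    Tendsto (fun x : ℝ => logFactor k u x - ((Real.log (x * u) : ℝ) : ℂ)) atTop
      (𝓝 (Real.eulerMascheroniConstant : ℂ)) := by
  have hu0 : (0:ℝ) < u := zero_lt_one.trans_le h.one_le
  have h1 : Tendsto (fun x : ℝ => ((ein (x * u) - Real.log (x * u) : ℝ) : ℂ)) atTop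
      (𝓝 (Real.eulerMascheroniConstant : ℂ)) :=
    (Complex.continuous_ofReal.tendsto _).comp
      (tendsto_ein_sub_log.comp (tendsto_id.atTop_mul_const hu0))
  have h2 : Tendsto (fun x : ℝ => logFactor k u x - (ein (x * u) : ℂ)) atTop (𝓝 0) := by
    refine squeeze_zero_norm' (a := fun x : ℝ => 2 * Real.exp (-x) * u) ?_ ?_
    · filter_upwards [eventually_gt_atTop 0] with x hx
      have e1 : (ein (x * u) : ℂ) =
          ∫ v in (0 : ℝ)..u, (((1 - Real.exp (-(x * v))) / v : ℝ) : ℂ) := by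
        have := intervalIntegral.integral_comp_mul_left (a := 0) (b := u)
          (fun t => (1 - Real.exp (-t)) / t) hx.ne'
        rw [mul_zero] at this
        rw [intervalIntegral.integral_ofReal, ein]
        congr 1
        rw [← smul_right_injective ℝ (inv_ne_zero hx.ne') |>.eq_iff]
        rw [← this, smul_eq_mul, ← intervalIntegral.integral_const_mul]
        refine intervalIntegral.integral_congr fun v _ => ?_
        field_simp
      have hi : IntervalIntegrable (fun v : ℝ => (((1 - Real.exp (-(x * v))) / v : ℝ) : ℂ))
          volume 0 u := by
        have h3 := (intervalIntegrable_one_sub_exp_neg_div le_rfl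
          (mul_pos hx hu0).le).comp_mul_left (c := x)
        rw [zero_div, mul_div_cancel_left₀ _ hx.ne'] at h3
        have h4 := (h3.const_mul x)
        have h5 : IntervalIntegrable
            (fun v : ℝ => ((x * ((1 - Real.exp (-(x * v))) / (x * v)) : ℝ) : ℂ)) volume 0 u :=
          ⟨Integrable.ofReal h4.1, Integrable.ofReal h4.2⟩
        refine h5.congr ?_
        intro v _
        field_simp
      rw [e1, logFactor, ← intervalIntegral.integral_sub
        (h.kernel.intervalIntegrable_logFactor hu0.le _) hi]
      have := intervalIntegral.norm_integral_le_of_norm_le_const (a := 0) (b := u)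
        (C := 2 * Real.exp (-x)) (f := fun v : ℝ => (1 - k v * Complex.exp (-((x:ℂ) * v))) / v -
          (((1 - Real.exp (-(x * v))) / v : ℝ) : ℂ)) ?_
      · simpa [abs_of_pos hu0] using this
      · intro v hv
        rw [uIoc_of_le hu0.le] at hv
        have e3 : (1 - k v * Complex.exp (-((x:ℂ) * v))) / v -
          (((1 - Real.exp (-(x * v))) / v : ℝ) : ℂ) =
            (1 - k v) * (Real.exp (-(x * v)) : ℂ) / v := by
          push_cast; ring
        rw [e3]
        rcases le_total v 1 with h1 | h1
        · rw [h.kernel.eq_one v hv.1.le h1]; simp; positivity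
        · rw [norm_div, norm_mul, Complex.norm_real, Complex.norm_real,
            Real.norm_of_nonneg hv.1.le, Real.norm_of_nonneg (Real.exp_pos _).le]
          refine (div_le_self (by positivity) h1).trans (mul_le_mul ?_ ?_ (Real.exp_pos _).le
            (by norm_num))
          · refine (norm_sub_le _ _).trans ?_
            have := h.causal_k.norm_le v
            rw [norm_one]; linarith
          · exact Real.exp_le_exp.2 (by nlinarith)
    · simpa using (Real.tendsto_exp_neg_atTop_nhds_zero.const_mul 2).mul_const u
  have h3 := h1.add h2
  rw [add_zero] at h3
  refine h3.congr fun x => ?_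
  push_cast; ring

/-- The explicit formula `F = u e^γ exp (-E)` for the Laplace transform of `s`. -/
theorem laplace_s_eq (h : IsTruncatedPair u k s) {z : ℂ} (hz : 0 < z.re) :
    laplace s z = u * Real.exp Real.eulerMascheroniConstant * Complex.exp (-logFactor k u z) := by
  have hu0 : (0:ℝ) < u := zero_lt_one.trans_le h.one_le
  have hopen : IsOpen {w : ℂ | 0 < w.re} := isOpen_lt continuous_const Complex.continuous_re
  have hpre : IsPreconnected {w : ℂ | 0 < w.re} :=
    (convex_halfSpace_re_gt 0).isPreconnected
  have hd : ∀ w ∈ {w : ℂ | 0 < w.re},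
      HasDerivAt (fun w => laplace s w * Complex.exp (logFactor k u w)) 0 w := fun w hw => by
    have := (h.causal_s.hasDerivAt_laplace hw).mul (h.kernel.hasDerivAt_logFactor hu0.le w).cexp
    refine this.congr_deriv ?_
    rw [h.integral_mul_exp_mul hw, ← h.laplace_k]
    ring
  have hconst : ∀ w ∈ {w : ℂ | 0 < w.re}, laplace s w * Complex.exp (logFactor k u w) =
      laplace s z * Complex.exp (logFactor k u z) := fun w hw =>
    hopen.is_const_of_deriv_eq_zero hpre
      (fun w hw => (hd w hw).differentiableAt.differentiableWithinAt)
      (fun w hw => (hd w hw).deriv) hw hz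
  have hlim : Tendsto (fun x : ℝ => laplace s x * Complex.exp (logFactor k u x)) atTop
      (𝓝 (1 * (u * Complex.exp Real.eulerMascheroniConstant))) := by
    have h1 := h.tendsto_mul_laplace.mul (((Complex.continuous_exp.tendsto _).comp
      h.tendsto_logFactor_sub).const_mul (u : ℂ))
    refine h1.congr' ?_
    filter_upwards [eventually_gt_atTop 0] with x hx
    have hxu : (0:ℝ) < x * u := mul_pos hx hu0
    have hxc : (x : ℂ) ≠ 0 := by exact_mod_cast hx.ne'
    have huc : (u : ℂ) ≠ 0 := by exact_mod_cast hu0.ne'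
    simp only [Function.comp]
    rw [Complex.exp_sub, ← Complex.ofReal_exp, Real.exp_log hxu]
    push_cast
    field_simp
  have hev : Tendsto (fun x : ℝ => laplace s x * Complex.exp (logFactor k u x)) atTop
      (𝓝 (laplace s z * Complex.exp (logFactor k u z))) :=
    tendsto_const_nhds.congr' (by
      filter_upwards [eventually_gt_atTop 0] with x hx
      exact (hconst x (by simpa using hx)).symm)
  have key := tendsto_nhds_unique hev hlim
  rw [Complex.exp_neg, Complex.ofReal_exp, ← one_mul ((u : ℂ) * _), ← key,
    mul_inv_cancel_right₀ (Complex.exp_ne_zero _)]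

/-- The maximum principle: a lower bound for the twisted distances bounds the Laplace transform of
`s` in the whole right half-plane. -/
theorem norm_laplace_le_of_le (h : IsTruncatedPair u k s) {m : ℝ}
    (hm : ∀ y, m ≤ twistedDistance k u y) {z : ℂ} (hz : 0 < z.re) :
    ‖laplace s z‖ ≤ u * Real.exp (Real.eulerMascheroniConstant - m) := by
  have hu0 : (0:ℝ) < u := zero_lt_one.trans_le h.one_le
  have hnorm : ∀ w, ‖Complex.exp (-logFactor k u w)‖ = Real.exp (-(logFactor k u w).re) :=
    fun w => by rw [Complex.norm_exp]; simp
  have key : ‖Complex.exp (-logFactor k u z)‖ ≤ Real.exp (-m) := by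
    refine PhragmenLindelof.right_half_plane_of_tendsto_zero_on_real
      (f := fun w => Complex.exp (-logFactor k u w)) ?_ ⟨1, by norm_num, 0, ?_⟩ ?_ ?_ hz.le
    · exact Differentiable.diffContOnCl
        fun w => ((h.kernel.hasDerivAt_logFactor hu0.le w).neg.cexp).differentiableAt
    · refine Asymptotics.IsBigO.of_bound 1 ?_
      filter_upwards [mem_inf_of_right (mem_principal_self _)] with w hw
      rw [hnorm]
      simpa using h.kernel.re_logFactor_nonneg hu0.le (le_of_lt hw)
    · have hc : (u : ℂ) * Real.exp Real.eulerMascheroniConstant ≠ 0 := by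
        exact_mod_cast (mul_pos hu0 (Real.exp_pos _)).ne'
      have h1 := (h.tendsto_mul_laplace.mul
        ((Complex.continuous_ofReal.tendsto 0).comp tendsto_inv_atTop_zero)).const_mul
          ((u : ℂ) * Real.exp Real.eulerMascheroniConstant)⁻¹
      simp only [Complex.ofReal_zero, mul_zero] at h1
      refine h1.congr' ?_
      filter_upwards [eventually_gt_atTop 0] with x hx
      have hxc : (x : ℂ) ≠ 0 := by exact_mod_cast hx.ne'
      have huc : (u : ℂ) ≠ 0 := by exact_mod_cast hu0.ne'
      simp only [Function.comp]
      rw [h.laplace_s_eq (z := x) (by simpa using hx)]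
      push_cast at hc ⊢
      field_simp
    · intro y
      rw [hnorm, ← h.kernel.twistedDistance_eq hu0.le]
      exact Real.exp_le_exp.2 (neg_le_neg (hm y))
  rw [h.laplace_s_eq hz, norm_mul, norm_mul, Complex.norm_real, Complex.norm_real,
    Real.norm_of_nonneg hu0.le, Real.norm_of_nonneg (Real.exp_pos _).le, sub_eq_add_neg,
    Real.exp_add, ← mul_assoc]
  exact mul_le_mul_of_nonneg_left key (by positivity)

end IsTruncatedPair

/-! ### The mean square bound and the upper bound for solutions -/

open scoped FourierTransform in
theorem fourier_exp_mul_eq_laplace (f : ℝ → ℂ) (α ξ : ℝ) :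
    𝓕 (fun t : ℝ => Complex.exp (-((α : ℂ) * t)) * f t) ξ =
      laplace f (α + (2 * Real.pi * ξ : ℝ) * Complex.I) := by
  rw [Real.fourier_real_eq_integral_exp_smul, laplace]
  refine integral_congr_ae (Eventually.of_forall fun t => ?_)
  simp only [smul_eq_mul]
  rw [← mul_assoc, ← Complex.exp_add]
  congr 2
  push_cast
  ring

theorem memLp_two_of_le_expDecay {f : ℝ → ℂ} (hf : AEStronglyMeasurable f volume) {C c : ℝ}
    (hc : 0 < c) (h : ∀ t, ‖f t‖ ≤ C * expDecay c t) : MemLp f 2 := by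
  rw [memLp_two_iff_integrable_sq_norm hf]
  refine ((integrable_expDecay (c := 2 * c) (by linarith)).const_mul (C ^ 2)).mono'
    (hf.norm.pow 2) (Eventually.of_forall fun t => ?_)
  rw [Real.norm_of_nonneg (by positivity)]
  refine (pow_le_pow_left₀ (norm_nonneg _) (h t) 2).trans (le_of_eq ?_)
  rw [mul_pow]
  congr 1
  by_cases ht : t ∈ Ici (0:ℝ)
  · rw [expDecay, expDecay, indicator_of_mem ht, indicator_of_mem ht, ← Real.exp_nat_mul]
    push_cast; ring_nf
  · rw [expDecay, expDecay, indicator_of_notMem ht, indicator_of_notMem ht]; simp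

theorem lintegral_Ioi_exp {x : ℝ} (hx : 0 < x) (c : ℝ) :
    ∫⁻ t in Ioi c, ENNReal.ofReal (Real.exp (-x * t)) = ENNReal.ofReal (Real.exp (-x * c) / x) := by
  rw [← ofReal_integral_eq_lintegral_ofReal (integrableOn_exp_mul_Ioi (neg_lt_zero.2 hx) c)
    (Eventually.of_forall fun t => (Real.exp_pos _).le), integral_exp_mul_Ioi (neg_lt_zero.2 hx),
    neg_div_neg_eq]

theorem lintegral_Ioc_exp {x u : ℝ} (hx : 0 < x) (hu : 0 ≤ u) :
    ∫⁻ t in Ioc 0 u, ENNReal.ofReal (Real.exp (-x * t)) =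
      ENNReal.ofReal ((1 - Real.exp (-x * u)) / x) := by
  rw [← ofReal_integral_eq_lintegral_ofReal
    ((by fun_prop : Continuous fun t => Real.exp (-x * t)).integrableOn_Ioc)
    (Eventually.of_forall fun t => (Real.exp_pos _).le), ← intervalIntegral.integral_of_le hu]
  have : ∀ t ∈ uIcc 0 u, HasDerivAt (fun t : ℝ => - Real.exp (-x * t) / x)
      (Real.exp (-x * t)) t := fun t _ =>
    (((hasDerivAt_id t).const_mul (-x)).exp.neg.div_const x).congr_deriv
      (by simp only [id]; field_simp)
  rw [intervalIntegral.integral_eq_sub_of_hasDerivAt this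
    (Continuous.intervalIntegrable (by fun_prop) _ _)]
  congr 1
  simp; ring

namespace IsTruncatedPair

variable {u : ℝ} {k s : ℝ → ℂ}

open scoped Convolution in
/-- The weighted function `t s(t) e^{-αt}` is the convolution of the weighted `s` and `k`. -/
theorem eLpNorm_mul_exp_mul_le (h : IsTruncatedPair u k s) {α B : ℝ} (hα : 0 < α)
    (hB : ∀ z : ℂ, z.re = α → ‖laplace s z‖ ≤ B) :
    eLpNorm (fun t : ℝ => (t : ℂ) * (Complex.exp (-((α : ℂ) * t)) * s t)) 2 volume ≤
      ENNReal.ofReal B * eLpNorm (fun t : ℝ => Complex.exp (-((α : ℂ) * t)) * k t) 2 volume := by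
  have hαc : 0 < (α : ℂ).re := by simpa using hα
  refine eLpNorm_convolution_le (h.causal_s.integrable_exp_mul hαc)
    (h.causal_k.integrable_exp_mul hαc) ?_ ?_ (fun t => ?_) (fun ξ => ?_)
  · exact memLp_two_of_le_expDecay (h.causal_k.aestronglyMeasurable_exp_mul _) (C := 1) hα
      fun t => by rw [one_mul]; exact h.causal_k.norm_exp_mul_le (by simp) t
  · exact memLp_two_of_le_expDecay (h.causal_s.aestronglyMeasurable_mul_exp_mul _) (half_pos hα)
      fun t => h.causal_s.norm_mul_exp_mul_le hα (by simp) t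
  · simp only [convolution_def, ContinuousLinearMap.mul_apply']
    rw [mul_left_comm, h.equation t, ← integral_const_mul]
    refine integral_congr_ae (Eventually.of_forall fun x => ?_)
    have : Complex.exp (-((α:ℂ) * t)) =
        Complex.exp (-((α:ℂ) * x)) * Complex.exp (-((α:ℂ) * ((t - x : ℝ) : ℂ))) := by
      rw [← Complex.exp_add]; push_cast; ring_nf
    simp only [this]
    ring
  · rw [fourier_exp_mul_eq_laplace]
    exact hB _ (by simp)

/-- The mean square estimate: Plancherel bounds `t s(t) e^{-xt/2}` in `L²`, and the Cauchy–Schwarz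
inequality on `S` turns this into a weighted mean of `|s|`. -/
theorem lintegral_mul_exp_le (h : IsTruncatedPair u k s) {x B : ℝ} (hx : 0 < x)
    (hB : ∀ z : ℂ, z.re = x / 2 → ‖laplace s z‖ ≤ B) {S : Set ℝ} (hS : MeasurableSet S)
    (hS1 : Ioc 0 u ⊆ S) (hS2 : S ⊆ Ioi 0) :
    ∫⁻ t in S, ENNReal.ofReal (t * ‖s t‖ * Real.exp (-x * t)) ≤
      ENNReal.ofReal B * ∫⁻ t in S, ENNReal.ofReal (Real.exp (-x * t)) := by
  set c : ℝ → ℂ := fun t : ℝ => (t : ℂ) * (Complex.exp (-(((x / 2 : ℝ) : ℂ) * t)) * s t) with hc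
  set b : ℝ → ℂ := fun t : ℝ => Complex.exp (-(((x / 2 : ℝ) : ℂ) * t)) * k t with hb
  set Q := ∫⁻ t in S, ENNReal.ofReal (Real.exp (-x * t)) with hQ
  have hne : ∀ t : ℝ, ‖Complex.exp (-(((x / 2 : ℝ) : ℂ) * t))‖ = Real.exp (-(x / 2) * t) :=
    fun t => by rw [norm_exp_neg_mul]; simp
  have hsq : ∀ t : ℝ, ENNReal.ofReal (Real.exp (-(x / 2) * t)) ^ (2:ℝ) =
      ENNReal.ofReal (Real.exp (-x * t)) := fun t => by
    rw [ENNReal.ofReal_rpow_of_pos (Real.exp_pos _), ← Real.exp_mul]; ring_nf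
  have h1 : eLpNorm c 2 volume ≤ ENNReal.ofReal B * eLpNorm b 2 volume :=
    h.eLpNorm_mul_exp_mul_le (half_pos hx) hB
  have h2 : eLpNorm b 2 volume ≤ Q ^ (1 / 2 : ℝ) := by
    rw [eLpNorm_eq_lintegral_rpow_enorm_toReal (by norm_num) (by norm_num)]
    simp only [ENNReal.toReal_ofNat]
    refine ENNReal.rpow_le_rpow ?_ (by norm_num)
    rw [hQ, ← lintegral_indicator hS]
    refine lintegral_mono_ae ?_
    have h0 : ({0}ᶜ : Set ℝ) ∈ ae volume := compl_mem_ae_iff.2 (by simp)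
    filter_upwards [h0] with t ht
    by_cases htS : t ∈ S
    · rw [indicator_of_mem htS, ← hsq]
      refine ENNReal.rpow_le_rpow ?_ (by norm_num)
      rw [← ofReal_norm]
      refine ENNReal.ofReal_le_ofReal ?_
      rw [hb, norm_mul, hne]
      exact mul_le_of_le_one_right (Real.exp_pos _).le (h.causal_k.norm_le t)
    · rw [indicator_of_notMem htS]
      have : k t = 0 := by
        rcases lt_or_ge t 0 with h3 | h3
        · exact h.causal_k.eq_zero t h3
        · refine h.k_eq_zero t (not_le.1 fun h4 => htS (hS1 ⟨lt_of_le_of_ne h3 (Ne.symm ht), h4⟩))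
      simp [hb, this]
  have h3 : (∫⁻ t in S, ‖c t‖ₑ ^ (2:ℝ)) ^ (1 / 2 : ℝ) ≤ eLpNorm c 2 volume := by
    rw [eLpNorm_eq_lintegral_rpow_enorm_toReal (by norm_num) (by norm_num)]
    simp only [ENNReal.toReal_ofNat]
    exact ENNReal.rpow_le_rpow (setLIntegral_le_lintegral _ _) (by norm_num)
  have h4 : ∫⁻ t in S, ENNReal.ofReal (t * ‖s t‖ * Real.exp (-x * t)) =
      ∫⁻ t in S, ((fun t => ‖c t‖ₑ) * fun t => ENNReal.ofReal (Real.exp (-(x / 2) * t))) t := by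
    refine setLIntegral_congr_fun hS fun t ht => ?_
    have ht0 : (0:ℝ) < t := hS2 ht
    simp only [Pi.mul_apply]
    rw [← ofReal_norm, hc, ← ENNReal.ofReal_mul (norm_nonneg _)]
    simp only [norm_mul, hne, Complex.norm_real, Real.norm_of_nonneg ht0.le]
    congr 1
    have : Real.exp (-x * t) = Real.exp (-(x / 2) * t) * Real.exp (-(x / 2) * t) := by
      rw [← Real.exp_add]; ring_nf
    rw [this]; ring
  have h5 := ENNReal.lintegral_mul_le_Lp_mul_Lq (volume.restrict S)
    (Real.HolderConjugate.two_two) (f := fun t => ‖c t‖ₑ)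
    (g := fun t => ENNReal.ofReal (Real.exp (-(x / 2) * t)))
    (h.causal_s.aestronglyMeasurable_mul_exp_mul _).enorm.restrict (by fun_prop)
  rw [h4]
  refine h5.trans ?_
  simp only [hsq]
  calc _ ≤ ENNReal.ofReal B * Q ^ (1 / 2 : ℝ) * Q ^ (1 / 2 : ℝ) := by
        refine mul_le_mul_left (h3.trans (h1.trans ?_)) _
        exact mul_le_mul_right h2 _
    _ = ENNReal.ofReal B * Q := by
        rw [mul_assoc, ← ENNReal.rpow_add_of_nonneg _ _ (by norm_num) (by norm_num)]
        norm_num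

/-- The mean of `|s|`, from the bound `min (N, 2 / x)` for the Laplace transform on the line
`Re z = x / 2`. -/
theorem lintegral_norm_le (h : IsTruncatedPair u k s) {N : ℝ} (hN : 0 < N)
    (hB : ∀ z : ℂ, 0 < z.re → ‖laplace s z‖ ≤ N) :
    ∫⁻ t in Ioc 0 u, ENNReal.ofReal ‖s t‖ ≤ ENNReal.ofReal (N * (ein (2 * u / N) + 1)) := by
  have hu0 : (0:ℝ) < u := zero_lt_one.trans_le h.one_le
  have hsm : AEMeasurable (fun t => ‖s t‖) volume := h.causal_s.meas.norm.aemeasurable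
  -- `1 = ∫₀^∞ t e^{-xt} dx`, then exchange the integrals.
  have e1 : ∫⁻ t in Ioc 0 u, ENNReal.ofReal ‖s t‖ = ∫⁻ x in Ioi (0:ℝ), ∫⁻ t in Ioc 0 u,
      ENNReal.ofReal (t * ‖s t‖ * Real.exp (-x * t)) := by
    rw [lintegral_lintegral_swap]
    · refine setLIntegral_congr_fun measurableSet_Ioc fun t ht => ?_
      have ht0 : 0 < t := ht.1
      have : ∀ x, ENNReal.ofReal (t * ‖s t‖ * Real.exp (-x * t)) =
          ENNReal.ofReal (t * ‖s t‖) * ENNReal.ofReal (Real.exp (-t * x)) := fun x => by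
        rw [← ENNReal.ofReal_mul (by positivity)]; ring_nf
      simp only [this]
      rw [lintegral_const_mul _ (by fun_prop), lintegral_Ioi_exp ht0,
        ← ENNReal.ofReal_mul (by positivity), mul_zero, Real.exp_zero]
      congr 1
      field_simp
    · have h1 : AEMeasurable (fun p : ℝ × ℝ => ‖s p.2‖)
          ((volume.restrict (Ioi (0:ℝ))).prod (volume.restrict (Ioc 0 u))) :=
        hsm.restrict.comp_snd
      exact ((measurable_snd.aemeasurable.mul h1).mul (by fun_prop)).ennreal_ofReal
  have hbd : ∀ x, 0 < x → ∀ B, 0 ≤ B → (∀ z : ℂ, z.re = x / 2 → ‖laplace s z‖ ≤ B) →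
      ∫⁻ t in Ioc 0 u, ENNReal.ofReal (t * ‖s t‖ * Real.exp (-x * t)) ≤
        ENNReal.ofReal (B * ((1 - Real.exp (-x * u)) / x)) := fun x hx B hB0 hB => by
    rw [ENNReal.ofReal_mul hB0, ← lintegral_Ioc_exp hx hu0.le]
    exact h.lintegral_mul_exp_le hx hB measurableSet_Ioc subset_rfl Ioc_subset_Ioi_self
  have hβ : 0 < 2 / N := by positivity
  rw [e1, ← Ioc_union_Ioi_eq_Ioi hβ.le,
    lintegral_union measurableSet_Ioi (Ioc_disjoint_Ioi le_rfl)]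
  have hint : IntervalIntegrable (fun x => N * ((1 - Real.exp (-x * u)) / x)) volume 0 (2 / N) := by
    have h3 := (intervalIntegrable_one_sub_exp_neg_div le_rfl
      (mul_pos hu0 hβ).le).comp_mul_left (c := u)
    rw [zero_div, mul_div_cancel_left₀ _ hu0.ne'] at h3
    refine (h3.const_mul (N * u)).congr fun x _ => ?_
    rw [neg_mul, mul_comm u x, mul_div_assoc', mul_div_assoc']
    rw [mul_comm x u, mul_assoc, mul_left_comm, mul_div_mul_left _ _ hu0.ne']
  have hval : ∫ x in (0:ℝ)..(2 / N), N * ((1 - Real.exp (-x * u)) / x) =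
      N * ein (2 * u / N) := by
    rw [intervalIntegral.integral_const_mul]
    congr 1
    have := intervalIntegral.mul_integral_comp_mul_left (a := 0) (b := 2 / N) (c := u)
      (f := fun t => (1 - Real.exp (-t)) / t)
    rw [mul_zero] at this
    rw [ein, mul_comm 2 u, mul_div_assoc, ← this, ← intervalIntegral.integral_const_mul]
    refine intervalIntegral.integral_congr fun x _ => ?_
    rw [mul_div_assoc', mul_div_mul_left _ _ hu0.ne', neg_mul, mul_comm x u]
  have hnn : ∀ x, 0 < x → 0 ≤ (1 - Real.exp (-x * u)) / x := fun x hx =>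
    div_nonneg (sub_nonneg.2 (Real.exp_le_one_iff.2 (by nlinarith))) hx.le
  rw [mul_add, mul_one, ENNReal.ofReal_add
    (mul_nonneg hN.le (ein_nonneg (by positivity))) hN.le]
  refine add_le_add ?_ ?_
  · rw [← hval, intervalIntegral.integral_of_le hβ.le, ofReal_integral_eq_lintegral_ofReal
      ((intervalIntegrable_iff_integrableOn_Ioc_of_le hβ.le).1 hint)]
    · refine setLIntegral_mono' measurableSet_Ioc fun x hx => ?_
      exact hbd x hx.1 N hN.le fun z hz => hB z (by rw [hz]; linarith [hx.1])
    · filter_upwards [ae_restrict_mem measurableSet_Ioc] with x hx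
      exact mul_nonneg hN.le (hnn x hx.1)
  · have hI : IntegrableOn (fun x : ℝ => 2 * x ^ (-2 : ℝ)) (Ioi (2 / N)) :=
      (integrableOn_Ioi_rpow_of_lt (by norm_num) hβ).const_mul 2
    have hv : ∫ x in Ioi (2 / N), 2 * x ^ (-2 : ℝ) = N := by
      rw [integral_const_mul, integral_Ioi_rpow_of_lt (by norm_num) hβ]
      norm_num [Real.rpow_neg_one]
      ring
    nth_rw 2 [← hv]
    rw [ofReal_integral_eq_lintegral_ofReal hI]
    · refine setLIntegral_mono' measurableSet_Ioi fun x hx => ?_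
      have hx0 : 0 < x := hβ.trans hx
      refine (hbd x hx0 (2 / x) (by positivity) fun z hz => ?_).trans
        (ENNReal.ofReal_le_ofReal ?_)
      · have := h.causal_s.norm_laplace_le (z := z) (by rw [hz]; linarith)
        rwa [hz, one_div_div] at this
      · rw [Real.rpow_neg hx0.le, Real.rpow_two]
        have : (1 - Real.exp (-x * u)) / x ≤ 1 / x :=
          div_le_div_of_nonneg_right (by linarith [Real.exp_pos (-x * u)]) hx0.le
        calc 2 / x * ((1 - Real.exp (-x * u)) / x) ≤ 2 / x * (1 / x) :=
              mul_le_mul_of_nonneg_left this (by positivity)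
          _ = 2 * (x ^ 2)⁻¹ := by field_simp
    · filter_upwards [ae_restrict_mem measurableSet_Ioi] with x hx
      have hx0 : 0 < x := hβ.trans hx
      positivity

theorem integrableOn_norm (h : IsTruncatedPair u k s) (a b : ℝ) :
    IntegrableOn (fun t => ‖s t‖) (Ioc a b) :=
  Integrable.mono' (integrableOn_const (C := (1:ℝ)) (by simp)) h.causal_s.meas.norm.restrict
    (Eventually.of_forall fun t => by simpa using h.causal_s.norm_le t)

theorem integral_norm_le (h : IsTruncatedPair u k s) {N : ℝ} (hN : 0 < N)
    (hB : ∀ z : ℂ, 0 < z.re → ‖laplace s z‖ ≤ N) :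
    ∫ t in Ioc 0 u, ‖s t‖ ≤ N * (ein (2 * u / N) + 1) := by
  have hu0 : (0:ℝ) < u := zero_lt_one.trans_le h.one_le
  have h1 := h.lintegral_norm_le hN hB
  rw [← ofReal_integral_eq_lintegral_ofReal (h.integrableOn_norm 0 u)
    (Eventually.of_forall fun t => norm_nonneg _)] at h1
  refine (ENNReal.ofReal_le_ofReal_iff ?_).1 h1
  have : 0 ≤ ein (2 * u / N) := ein_nonneg (by positivity)
  positivity

end IsTruncatedPair

theorem IsSolution.norm_le_of_le_twistedDistance {χ σ : ℝ → ℂ} (hχ : IsUnitKernel χ)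
    (hσ : IsSolution χ σ) {u m : ℝ} (hu : 1 ≤ u) (hm : ∀ y, m ≤ twistedDistance χ u y) :
    ‖σ u‖ ≤ Real.exp (Real.eulerMascheroniConstant - m) *
      (ein (2 * Real.exp (m - Real.eulerMascheroniConstant)) + 1) := by
  have hu0 : (0:ℝ) < u := zero_lt_one.trans_le hu
  obtain ⟨k, s, h, hk, hs⟩ := hσ.exists_isTruncatedPair hχ hu
  have hm' : ∀ y, m ≤ twistedDistance k u y := fun y => by
    rw [h.kernel.twistedDistance_eq hu0.le, logFactor_congr hu0.le hk,
      ← hχ.twistedDistance_eq hu0.le]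
    exact hm y
  have h1 := h.integral_norm_le (N := u * Real.exp (Real.eulerMascheroniConstant - m))
    (by positivity) fun z hz => h.norm_laplace_le_of_le hm' hz
  have e : 2 * u / (u * Real.exp (Real.eulerMascheroniConstant - m)) =
      2 * Real.exp (m - Real.eulerMascheroniConstant) := by
    rw [← neg_sub m, Real.exp_neg]
    field_simp
  rw [e] at h1
  have h2 := norm_integral_mul_kernel_le hχ hu0.le (hσ.integrable u hu0.le)
  rw [← hσ.equation u hu0.le, norm_mul, Complex.norm_real, Real.norm_of_nonneg hu0.le,
    intervalIntegral.integral_of_le hu0.le] at h2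
  have h3 : ∫ t in Ioc 0 u, ‖σ t‖ = ∫ t in Ioc 0 u, ‖s t‖ :=
    setIntegral_congr_fun measurableSet_Ioc fun t ht => by simp only [hs t ht.1.le ht.2]
  rw [h3] at h2
  have h4 := h2.trans h1
  rw [mul_assoc] at h4
  exact le_of_mul_le_mul_left h4 hu0

/-- The bound `(M + 12 / 7) e^{c - M}` decreases in `M`, so lower bounds for `M` may be inserted. -/
theorem add_mul_exp_antitone {c M M' : ℝ} (hM : 0 ≤ M) (hMM' : M ≤ M') :
    (M' + 12 / 7) * Real.exp (c - M') ≤ (M + 12 / 7) * Real.exp (c - M) := by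
  have e : Real.exp (c - M) = Real.exp (c - M') * Real.exp (M' - M) := by
    rw [← Real.exp_add]; ring_nf
  have h1 := Real.add_one_le_exp (M' - M)
  have h2 := Real.exp_pos (c - M')
  rw [e]
  have : M' + 12 / 7 ≤ (M + 12 / 7) * Real.exp (M' - M) := by nlinarith
  nlinarith

/-- The upper bound with any lower bound `m` for the twisted distances in place of the minimum. The
hypothesis `hu1` covers `u ≤ 1`, where no kernel is truncated and only `|σ| ≤ 1` is used. -/
theorem IsSolution.norm_le_add_mul_exp {χ σ : ℝ → ℂ} (hχ : IsUnitKernel χ)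
    (hσ : IsSolution χ σ) {u m : ℝ} (hu : 0 ≤ u) (hm0 : 0 ≤ m) (hu1 : u ≤ 1 → m = 0)
    (hm : ∀ y, m ≤ twistedDistance χ u y) :
    ‖σ u‖ ≤ (m + 12 / 7) * Real.exp (Real.eulerMascheroniConstant - m) := by
  have hγ1 := Real.one_half_lt_eulerMascheroniConstant
  have hγ2 := Real.eulerMascheroniConstant_lt_two_thirds
  set γ := Real.eulerMascheroniConstant
  rcases le_total m (3 / 2) with h | h
  · -- Here the right-hand side is at least `1`.
    refine (hσ.norm_le_one hχ hu).trans (le_trans ?_ (add_mul_exp_antitone hm0 h))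
    have h1 : Real.exp (-1) ≤ Real.exp (γ - 3 / 2) := Real.exp_le_exp.2 (by linarith)
    have h2 := Real.exp_neg_one_gt_d9
    linarith
  · have hu' : 1 ≤ u := by
      by_contra hcon
      have := hu1 (not_le.1 hcon).le
      linarith
    refine (hσ.norm_le_of_le_twistedDistance hχ hu' hm).trans ?_
    rw [mul_comm]
    refine mul_le_mul_of_nonneg_right ?_ (Real.exp_pos _).le
    set w := 2 * Real.exp (m - γ) with hw
    have hw0 : 0 < w := by positivity
    have h1 := ein_le hw0
    have h2 : Real.log w = Real.log 2 + (m - γ) := by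
      rw [hw, Real.log_mul two_ne_zero (Real.exp_pos _).ne', Real.log_exp]
    have hw4 : 4 ≤ w := by
      have h3 := Real.quadratic_le_exp_of_nonneg (x := m - γ) (by linarith)
      nlinarith
    have h3 : Real.exp (-w) / w ≤ 1 / 64 := by
      have h4 : Real.exp (-w) ≤ 1 / 16 := by
        have h5 : Real.exp (-w) ≤ Real.exp (-4) := Real.exp_le_exp.2 (by linarith)
        have h6 : Real.exp (-4) = Real.exp (-1) ^ 4 := by rw [← Real.exp_nat_mul]; norm_num
        have h7 : Real.exp (-1) ≤ 1 / 2 := by linarith [Real.exp_neg_one_lt_d9]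
        have h8 := pow_le_pow_left₀ (Real.exp_pos (-1)).le h7 4
        linarith
      rw [div_le_div_iff₀ hw0 (by norm_num)]
      linarith
    have h4 := Real.log_two_lt_d9
    linarith

/-! ### The minimum over the twists is attained -/

theorem IsUnitKernel.integral_le_twistedDistance {χ : ℝ → ℂ} (hχ : IsUnitKernel χ) {a b u : ℝ}
    (ha : 0 ≤ a) (hab : a ≤ b) (hbu : b ≤ u) (y : ℝ) :
    ∫ v in a..b, (1 - (χ v * Complex.exp (-(Complex.I * v * y))).re) / v ≤
      twistedDistance χ u y := by
  have hu : 0 ≤ u := ha.trans (hab.trans hbu)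
  have hz : ∀ v : ℝ, Complex.I * v * y = y * Complex.I * v := fun v => by ring
  rw [twistedDistance]
  simp only [hz]
  refine intervalIntegral.integral_mono_interval ha hab hbu ?_
    (hχ.intervalIntegrable_re_logFactor hu _)
  filter_upwards [ae_restrict_mem measurableSet_Ioc] with v hv
  exact hχ.re_logFactor_integrand_nonneg (by simp) hv.1.le

theorem IsUnitKernel.twistedDistance_nonneg {χ : ℝ → ℂ} (hχ : IsUnitKernel χ) {u : ℝ}
    (hu : 0 ≤ u) (y : ℝ) : 0 ≤ twistedDistance χ u y := by
  rw [hχ.twistedDistance_eq hu]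
  exact hχ.re_logFactor_nonneg hu (by simp)

theorem IsUnitKernel.continuous_twistedDistance {χ : ℝ → ℂ} (hχ : IsUnitKernel χ) {u : ℝ}
    (hu : 0 ≤ u) : Continuous (twistedDistance χ u) := by
  have h1 : Continuous (logFactor χ u) := Differentiable.continuous (𝕜 := ℂ)
    fun z => (hχ.hasDerivAt_logFactor hu z).differentiableAt
  have h2 : twistedDistance χ u = fun y : ℝ => (logFactor χ u (y * Complex.I)).re :=
    funext fun y => hχ.twistedDistance_eq hu y
  rw [h2]
  exact Complex.continuous_re.comp (h1.comp (by fun_prop))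

open scoped FourierTransform in
/-- The Riemann–Lebesgue lemma shows that the contribution of `[a, min u 1]`, where `χ = 1`, tends
to `log (min u 1 / a)`, which is arbitrarily large. -/
theorem IsUnitKernel.tendsto_twistedDistance {χ : ℝ → ℂ} (hχ : IsUnitKernel χ) {u : ℝ}
    (hu : 0 < u) :
    Tendsto (fun w : ℝ => twistedDistance χ u (2 * Real.pi * w)) (cocompact ℝ) atTop := by
  rw [tendsto_atTop]
  intro C
  set m := min u 1 with hm
  have hm0 : 0 < m := lt_min hu one_pos
  set a := m * Real.exp (-(|C| + 1)) with ha
  have ha0 : 0 < a := by positivity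
  have ham : a ≤ m := mul_le_of_le_one_right hm0.le
    (Real.exp_le_one_iff.2 (by linarith [abs_nonneg C]))
  have hlog : Real.log (m / a) = |C| + 1 := by
    rw [ha, div_mul_cancel_left₀ hm0.ne', Real.log_inv, Real.log_exp, neg_neg]
  have hRL := Real.tendsto_integral_exp_smul_cocompact
    ((Ioc a m).indicator fun v : ℝ => ((v⁻¹ : ℝ) : ℂ))
  have hRL' := (tendsto_iff_norm_sub_tendsto_zero.1 hRL).eventually (gt_mem_nhds one_pos)
  filter_upwards [hRL'] with w hw
  rw [sub_zero] at hw
  refine le_trans ?_ (hχ.integral_le_twistedDistance ha0.le ham (min_le_left _ _) _)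
  have hne : ∀ v ∈ uIcc a m, v ≠ 0 := fun v hv => by
    rw [uIcc_of_le ham] at hv; exact (ha0.trans_le hv.1).ne'
  have hi1 : IntervalIntegrable (fun v : ℝ => v⁻¹) volume a m :=
    (continuousOn_inv₀.mono fun v hv => hne v hv).intervalIntegrable
  have hi2 : IntervalIntegrable (fun v : ℝ => Real.cos (2 * Real.pi * w * v) * v⁻¹) volume a m :=
    (ContinuousOn.mul (by fun_prop) (continuousOn_inv₀.mono fun v hv => hne v hv)).intervalIntegrable
  have e1 : ∫ v in a..m, (1 - (χ v * Complex.exp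
      (-(Complex.I * v * ((2 * Real.pi * w : ℝ) : ℂ)))).re) / v =
      ∫ v in a..m, (v⁻¹ - Real.cos (2 * Real.pi * w * v) * v⁻¹) := by
    refine intervalIntegral.integral_congr fun v hv => ?_
    rw [uIcc_of_le ham] at hv
    have h2 : Complex.exp (-(Complex.I * v * ((2 * Real.pi * w : ℝ) : ℂ))) =
        Complex.exp (((-(2 * Real.pi * w * v) : ℝ) : ℂ) * Complex.I) := by
      push_cast; ring_nf
    rw [hχ.eq_one v (ha0.le.trans hv.1) (hv.2.trans (min_le_right _ _)), one_mul, h2,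
      Complex.exp_ofReal_mul_I_re, Real.cos_neg]
    ring
  have e2 : ∫ v in a..m, Real.cos (2 * Real.pi * w * v) * v⁻¹ =
      (∫ v : ℝ, Real.fourierChar (-(v * w)) •
        (Ioc a m).indicator (fun v : ℝ => ((v⁻¹ : ℝ) : ℂ)) v).re := by
    have h3 : ∀ v : ℝ, Real.fourierChar (-(v * w)) •
        (Ioc a m).indicator (fun v : ℝ => ((v⁻¹ : ℝ) : ℂ)) v =
        (Ioc a m).indicator (fun v : ℝ => Complex.exp (((-(2 * Real.pi * w * v) : ℝ) : ℂ) *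
          Complex.I) * ((v⁻¹ : ℝ) : ℂ)) v := fun v => by
      by_cases hv : v ∈ Ioc a m
      · rw [indicator_of_mem hv, indicator_of_mem hv, Circle.smul_def, Real.fourierChar_apply,
          smul_eq_mul]
        congr 3
        push_cast; ring
      · rw [indicator_of_notMem hv, indicator_of_notMem hv, smul_zero]
    simp only [h3]
    rw [integral_indicator measurableSet_Ioc, ← intervalIntegral.integral_of_le ham]
    have h4 : IntervalIntegrable (fun v : ℝ => Complex.exp (((-(2 * Real.pi * w * v) : ℝ) : ℂ) *
          Complex.I) * ((v⁻¹ : ℝ) : ℂ)) volume a m :=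
      (ContinuousOn.mul (by fun_prop) (Complex.continuous_ofReal.comp_continuousOn
        (continuousOn_inv₀.mono fun v hv => hne v hv))).intervalIntegrable
    have h5 := Complex.reCLM.intervalIntegral_comp_comm h4
    simp only [Complex.reCLM_apply] at h5
    rw [← h5]
    refine intervalIntegral.integral_congr fun v _ => ?_
    rw [Complex.re_mul_ofReal, Complex.exp_ofReal_mul_I_re, Real.cos_neg]
  rw [e1, intervalIntegral.integral_sub hi1 hi2, integral_inv_of_pos ha0 hm0, hlog, e2]
  have := (Complex.re_le_norm _).trans_lt hw
  linarith [le_abs_self C]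

theorem IsUnitKernel.exists_twistedDistance_le {χ : ℝ → ℂ} (hχ : IsUnitKernel χ) {u : ℝ}
    (hu : 0 ≤ u) : ∃ y₀, ∀ y, twistedDistance χ u y₀ ≤ twistedDistance χ u y := by
  rcases hu.eq_or_lt with rfl | hu0
  · exact ⟨0, fun y => by simp [twistedDistance]⟩
  have hc : Continuous fun w : ℝ => twistedDistance χ u (2 * Real.pi * w) :=
    (hχ.continuous_twistedDistance hu).comp (by fun_prop)
  obtain ⟨w, hw⟩ := hc.exists_forall_le (hχ.tendsto_twistedDistance hu0)
  refine ⟨2 * Real.pi * w, fun y => ?_⟩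
  have := hw (y / (2 * Real.pi))
  rwa [mul_div_cancel₀ _ (by positivity : (2 * Real.pi) ≠ 0)] at this

theorem IsUnitKernel.bddBelow_twistedDistance {χ : ℝ → ℂ} (hχ : IsUnitKernel χ) {u : ℝ}
    (hu : 0 ≤ u) : BddBelow (range (twistedDistance χ u)) :=
  ⟨0, by rintro _ ⟨y, rfl⟩; exact hχ.twistedDistance_nonneg hu y⟩

theorem IsUnitKernel.isLeast_minDistance {χ : ℝ → ℂ} (hχ : IsUnitKernel χ) {u : ℝ}
    (hu : 0 ≤ u) : IsLeast (range (twistedDistance χ u)) (minDistance χ u) := by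
  obtain ⟨y, hy⟩ := hχ.exists_twistedDistance_le hu
  have : minDistance χ u = twistedDistance χ u y :=
    le_antisymm (ciInf_le (hχ.bddBelow_twistedDistance hu) y) (le_ciInf hy)
  rw [this]
  exact ⟨⟨y, rfl⟩, by rintro _ ⟨y', rfl⟩; exact hy y'⟩

theorem IsUnitKernel.minDistance_nonneg {χ : ℝ → ℂ} (hχ : IsUnitKernel χ) {u : ℝ}
    (hu : 0 ≤ u) : 0 ≤ minDistance χ u :=
  le_ciInf fun y => hχ.twistedDistance_nonneg hu y

theorem IsUnitKernel.minDistance_eq_zero {χ : ℝ → ℂ} (hχ : IsUnitKernel χ) {u : ℝ}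
    (hu : 0 ≤ u) (hu1 : u ≤ 1) : minDistance χ u = 0 := by
  refine le_antisymm ?_ (hχ.minDistance_nonneg hu)
  refine (ciInf_le (hχ.bddBelow_twistedDistance hu) 0).trans (le_of_eq ?_)
  refine intervalIntegral.integral_zero_ae (Eventually.of_forall fun v hv => ?_)
  rw [uIoc_of_le hu] at hv
  simp [hχ.eq_one v hv.1.le (hv.2.trans hu1)]

theorem IsSolution.norm_le {χ σ : ℝ → ℂ} (hχ : IsUnitKernel χ) (hσ : IsSolution χ σ) {u : ℝ}
    (hu : 0 ≤ u) : ‖σ u‖ ≤ (minDistance χ u + 12 / 7) *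
      Real.exp (Real.eulerMascheroniConstant - minDistance χ u) :=
  hσ.norm_le_add_mul_exp hχ hu (hχ.minDistance_nonneg hu) (hχ.minDistance_eq_zero hu)
    fun y => ciInf_le (hχ.bddBelow_twistedDistance hu) y

/-! ### Bounds for the sine integral -/

theorem intervalIntegrable_sin_div {a b : ℝ} :
    IntervalIntegrable (fun w => Real.sin w / w) volume a b := by
  refine (intervalIntegrable_const (c := (1:ℝ))).mono_fun
    (Measurable.aestronglyMeasurable (by fun_prop)) (Eventually.of_forall fun t => ?_)
  simp only [norm_div, norm_one]
  exact div_le_one_of_le₀ Real.abs_sin_le_abs (norm_nonneg _)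

/-- Integration by parts of `sin w / w`. -/
theorem abs_integral_sin_div_sub_le {a b : ℝ} (ha : 0 < a) (hab : a ≤ b) :
    |(∫ w in a..b, Real.sin w / w) - Real.cos a / a| ≤ 1 / a := by
  have hne : ∀ w ∈ uIcc a b, w ≠ 0 := fun w hw => by
    rw [uIcc_of_le hab] at hw; exact (ha.trans_le hw.1).ne'
  have hi : IntervalIntegrable (fun w => Real.cos w / w ^ 2) volume a b :=
    (ContinuousOn.div (by fun_prop) (by fun_prop)
      fun w hw => pow_ne_zero 2 (hne w hw)).intervalIntegrable
  have hi2 : IntervalIntegrable (fun w : ℝ => 1 / w ^ 2) volume a b :=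
    (ContinuousOn.div (by fun_prop) (by fun_prop)
      fun w hw => pow_ne_zero 2 (hne w hw)).intervalIntegrable
  have h1 : ∫ w in a..b, (Real.sin w / w + Real.cos w / w ^ 2) =
      -(Real.cos b / b) - -(Real.cos a / a) := by
    refine intervalIntegral.integral_eq_sub_of_hasDerivAt (f := fun w => -(Real.cos w / w))
      (fun w hw => ?_) (intervalIntegrable_sin_div.add hi)
    have hw0 := hne w hw
    refine (((Real.hasDerivAt_cos w).div (hasDerivAt_id w) hw0).neg).congr_deriv ?_
    simp only [id]
    field_simp
    ring
  have h2 : ∫ w in a..b, (1:ℝ) / w ^ 2 = -(1 / b) - -(1 / a) := by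
    refine intervalIntegral.integral_eq_sub_of_hasDerivAt (f := fun w => -(1 / w))
      (fun w hw => ?_) hi2
    have hw0 := hne w hw
    refine (((hasDerivAt_const w (1:ℝ)).div (hasDerivAt_id w) hw0).neg).congr_deriv ?_
    simp only [id]
    field_simp
    ring
  have h3 : |∫ w in a..b, Real.cos w / w ^ 2| ≤ ∫ w in a..b, (1:ℝ) / w ^ 2 := by
    rw [← Real.norm_eq_abs]
    refine intervalIntegral.norm_integral_le_of_norm_le hab (Eventually.of_forall fun w _ => ?_) hi2
    rw [Real.norm_eq_abs, abs_div, abs_of_nonneg (sq_nonneg w)]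
    exact div_le_div_of_nonneg_right (Real.abs_cos_le_one w) (sq_nonneg w)
  rw [intervalIntegral.integral_add intervalIntegrable_sin_div hi] at h1
  rw [h2] at h3
  have hb : 0 < b := ha.trans_le hab
  have h4 : |Real.cos b / b| ≤ 1 / b := by
    rw [abs_div, abs_of_pos hb]
    exact div_le_div_of_nonneg_right (Real.abs_cos_le_one b) hb.le
  have h5 : (∫ w in a..b, Real.sin w / w) - Real.cos a / a =
      -(Real.cos b / b) - ∫ w in a..b, Real.cos w / w ^ 2 := by linarith
  rw [h5]
  refine (abs_sub _ _).trans ?_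
  rw [abs_neg]
  linarith

/-- A uniform bound for `∫ sin w / w` over intervals in `(0, ∞)`: the point `π / 2` is a convenient
place to split because the boundary term `cos (π / 2)` vanishes there. -/
theorem abs_integral_sin_div_le {a b : ℝ} (ha : 0 < a) (hab : a ≤ b) :
    |∫ w in a..b, Real.sin w / w| ≤ Real.pi / 2 + 2 / Real.pi := by
  have hpi := Real.pi_pos
  have hpi3 := Real.pi_gt_three
  have hsmall : ∀ {p q : ℝ}, 0 < p → p ≤ q → |∫ w in p..q, Real.sin w / w| ≤ q - p := by
    intro p q hp hpq
    have := intervalIntegral.norm_integral_le_of_norm_le_const (a := p) (b := q) (C := 1)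
      (f := fun w => Real.sin w / w) fun w _ => by
        rw [norm_div]; exact div_le_one_of_le₀ Real.abs_sin_le_abs (norm_nonneg _)
    rwa [one_mul, abs_of_nonneg (sub_nonneg.2 hpq)] at this
  have h2pi : 0 < 2 / Real.pi := by positivity
  rcases le_total (Real.pi / 2) a with h1 | h1
  · have h2 := abs_integral_sin_div_sub_le ha hab
    have h3 : |Real.cos a / a| ≤ 1 / a := by
      rw [abs_div, abs_of_pos ha]
      exact div_le_div_of_nonneg_right (Real.abs_cos_le_one a) ha.le
    have h4 : 1 / a ≤ 2 / Real.pi := by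
      rw [div_le_div_iff₀ ha hpi]; linarith
    have h5 : 2 / Real.pi ≤ Real.pi / 2 := by
      rw [div_le_div_iff₀ hpi two_pos]; nlinarith
    have h6 := abs_sub_abs_le_abs_sub (∫ w in a..b, Real.sin w / w) (Real.cos a / a)
    linarith
  rcases le_total b (Real.pi / 2) with h2 | h2
  · have := hsmall ha hab
    linarith
  · rw [← intervalIntegral.integral_add_adjacent_intervals
      (intervalIntegrable_sin_div (a := a) (b := Real.pi / 2)) intervalIntegrable_sin_div]
    refine (abs_add_le _ _).trans ?_
    have h3 := hsmall ha h1
    have h4 := abs_integral_sin_div_sub_le (half_pos hpi) h2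
    rw [Real.cos_pi_div_two, zero_div, sub_zero, one_div_div] at h4
    linarith

theorem abs_integral_sin_mul_div_le {b : ℝ} (hb : 1 ≤ b) (y : ℝ) :
    |∫ v in (1:ℝ)..b, Real.sin (y * v) / v| ≤ Real.pi / 2 + 2 / Real.pi := by
  have key : ∀ y : ℝ, 0 < y →
      |∫ v in (1:ℝ)..b, Real.sin (y * v) / v| ≤ Real.pi / 2 + 2 / Real.pi := by
    intro y hy
    have h1 := intervalIntegral.mul_integral_comp_mul_left (a := 1) (b := b) (c := y)
      (f := fun w => Real.sin w / w)
    have h2 : ∫ v in (1:ℝ)..b, Real.sin (y * v) / v =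
        y * ∫ v in (1:ℝ)..b, Real.sin (y * v) / (y * v) := by
      rw [← intervalIntegral.integral_const_mul]
      refine intervalIntegral.integral_congr fun v _ => ?_
      rw [mul_div_assoc', mul_div_mul_left _ _ hy.ne']
    rw [h2, h1, mul_one]
    exact abs_integral_sin_div_le hy (by nlinarith)
  rcases lt_trichotomy y 0 with hy | rfl | hy
  · have := key (-y) (by linarith)
    simpa [neg_mul, Real.sin_neg, neg_div, intervalIntegral.integral_neg] using this
  · simp; positivity
  · exact key y hy

/-! ### The kernel that equals `i` after `1` -/

/-- If `χ = i` on `(1, b)`, no twist brings the distance below `log b - O(1)`. -/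
theorem IsUnitKernel.log_sub_le_twistedDistance {χ : ℝ → ℂ} (hχ : IsUnitKernel χ) {b u : ℝ}
    (hb : 1 ≤ b) (hbu : b ≤ u) (hI : ∀ v, 1 < v → v < b → χ v = Complex.I) (y : ℝ) :
    Real.log b - (Real.pi / 2 + 2 / Real.pi) ≤ twistedDistance χ u y := by
  refine le_trans ?_ (hχ.integral_le_twistedDistance zero_le_one hb hbu y)
  have e : ∫ v in (1:ℝ)..b, (1 - (χ v * Complex.exp (-(Complex.I * v * y))).re) / v =
      ∫ v in (1:ℝ)..b, (v⁻¹ - Real.sin (y * v) / v) := by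
    refine intervalIntegral.integral_congr_ae ?_
    have h0 : ({b}ᶜ : Set ℝ) ∈ ae volume := compl_mem_ae_iff.2 (by simp)
    filter_upwards [h0] with v hvb hv
    rw [uIoc_of_le hb] at hv
    have h2 : Complex.exp (-(Complex.I * v * y)) =
        Complex.exp (((-(y * v) : ℝ) : ℂ) * Complex.I) := by
      push_cast; ring_nf
    rw [hI v hv.1 (lt_of_le_of_ne hv.2 hvb), h2, Complex.I_mul_re, Complex.exp_ofReal_mul_I_im,
      Real.sin_neg]
    ring
  have hne : ∀ w ∈ uIcc 1 b, w ≠ 0 := fun w hw => by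
    rw [uIcc_of_le hb] at hw; exact (zero_lt_one.trans_le hw.1).ne'
  have hi : IntervalIntegrable (fun v => Real.sin (y * v) / v) volume 1 b :=
    (ContinuousOn.div (by fun_prop) (by fun_prop) hne).intervalIntegrable
  have hi2 : IntervalIntegrable (fun v : ℝ => v⁻¹) volume 1 b :=
    (continuousOn_inv₀.mono hne).intervalIntegrable
  rw [e, intervalIntegral.integral_sub hi2 hi,
    integral_inv_of_pos one_pos (zero_lt_one.trans_le hb), div_one]
  have := (abs_le.1 (abs_integral_sin_mul_div_le hb y)).2
  linarith

namespace IsTruncatedPair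

variable {u : ℝ} {k s : ℝ → ℂ}

/-- On the positive real axis the values `k = i` contribute exactly `log u` to the real part of
`logFactor`, which cancels the factor `u` in the formula for the transform of `s`. -/
theorem le_norm_laplace_s (h : IsTruncatedPair u k s) (hI : ∀ v, 1 < v → v < u → k v = Complex.I)
    {x : ℝ} (hx : 0 < x) :
    Real.exp Real.eulerMascheroniConstant * Real.exp (-x) ≤ ‖laplace s x‖ := by
  have hu0 : (0:ℝ) < u := zero_lt_one.trans_le h.one_le
  have hi := h.kernel.intervalIntegrable_re_logFactor hu0.le (x : ℂ)
  have hsub1 : uIcc 0 1 ⊆ uIcc 0 u := by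
    rw [uIcc_of_le zero_le_one, uIcc_of_le hu0.le]; exact Icc_subset_Icc_right h.one_le
  have hsub2 : uIcc 1 u ⊆ uIcc 0 u := by
    rw [uIcc_of_le h.one_le, uIcc_of_le hu0.le]; exact Icc_subset_Icc_left zero_le_one
  have hre : ∀ v : ℝ, Complex.exp (-((x:ℂ) * v)) = (Real.exp (-(x * v)) : ℂ) := fun v => by
    push_cast; rfl
  have e1 : ∫ v in (0:ℝ)..1, (1 - (k v * Complex.exp (-((x:ℂ) * v))).re) / v ≤ x := by
    have := intervalIntegral.integral_mono_on (μ := volume) zero_le_one (hi.mono_set hsub1)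
      (intervalIntegrable_const (c := x)) fun v hv => ?_
    · simpa using this
    · rw [h.kernel.eq_one v hv.1 hv.2, one_mul, hre, Complex.ofReal_re]
      rcases hv.1.eq_or_lt with rfl | hv0
      · simpa using hx.le
      · rw [div_le_iff₀ hv0]; linarith [Real.add_one_le_exp (-(x * v))]
  have e2 : ∫ v in (1:ℝ)..u, (1 - (k v * Complex.exp (-((x:ℂ) * v))).re) / v = Real.log u := by
    have : ∫ v in (1:ℝ)..u, (1 - (k v * Complex.exp (-((x:ℂ) * v))).re) / v =
        ∫ v in (1:ℝ)..u, v⁻¹ := by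
      refine intervalIntegral.integral_congr_ae ?_
      have h0 : ({u}ᶜ : Set ℝ) ∈ ae volume := compl_mem_ae_iff.2 (by simp)
      filter_upwards [h0] with v hvb hv
      rw [uIoc_of_le h.one_le] at hv
      rw [hI v hv.1 (lt_of_le_of_ne hv.2 hvb), hre, Complex.I_mul_re, Complex.ofReal_im]
      simp
    rw [this, integral_inv_of_pos one_pos hu0, div_one]
  have e3 : (logFactor k u x).re ≤ x + Real.log u := by
    rw [h.kernel.re_logFactor hu0.le, ← intervalIntegral.integral_add_adjacent_intervals
      (hi.mono_set hsub1) (hi.mono_set hsub2), e2]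
    linarith
  rw [h.laplace_s_eq (by simpa using hx), norm_mul, norm_mul, Complex.norm_real, Complex.norm_real,
    Real.norm_of_nonneg hu0.le, Real.norm_of_nonneg (Real.exp_pos _).le, Complex.norm_exp,
    Complex.neg_re]
  have e4 : Real.exp (-(x + Real.log u)) ≤ Real.exp (-(logFactor k u x).re) :=
    Real.exp_le_exp.2 (neg_le_neg e3)
  rw [neg_add, Real.exp_add, Real.exp_neg (Real.log u), Real.exp_log hu0] at e4
  calc _ = u * Real.exp Real.eulerMascheroniConstant * (Real.exp (-x) * u⁻¹) := by
        field_simp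
    _ ≤ _ := mul_le_mul_of_nonneg_left e4 (by positivity)

/-- The imaginary part of the transform of `k` is `∫₁ᵘ e^{-xv} dv`. -/
theorem le_norm_laplace_k (h : IsTruncatedPair u k s) (hI : ∀ v, 1 < v → v < u → k v = Complex.I)
    {x : ℝ} (hx : 0 < x) :
    (Real.exp (-x) - Real.exp (-x * u)) / x ≤ ‖laplace k x‖ := by
  have hu0 : (0:ℝ) < u := zero_lt_one.trans_le h.one_le
  refine le_trans (le_of_eq ?_) ((le_abs_self _).trans (Complex.abs_im_le_norm _))
  have hre : ∀ v : ℝ, Complex.exp (-((x:ℂ) * v)) = (Real.exp (-(x * v)) : ℂ) := fun v => by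
    push_cast; rfl
  have hi : IntervalIntegrable (fun v => k v * Complex.exp (-((x:ℂ) * v))) volume 0 u := by
    have := (h.causal_k.integrable_exp_mul (z := x) (by simpa using hx)).intervalIntegrable
      (a := 0) (b := u)
    simpa only [mul_comm] using this
  have hi2 : IntervalIntegrable (fun v => (k v * Complex.exp (-((x:ℂ) * v))).im) volume 0 u :=
    ⟨Integrable.im hi.1, Integrable.im hi.2⟩
  have hsub1 : uIcc 0 1 ⊆ uIcc 0 u := by
    rw [uIcc_of_le zero_le_one, uIcc_of_le hu0.le]; exact Icc_subset_Icc_right h.one_le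
  have hsub2 : uIcc 1 u ⊆ uIcc 0 u := by
    rw [uIcc_of_le h.one_le, uIcc_of_le hu0.le]; exact Icc_subset_Icc_left zero_le_one
  have e0 := Complex.imCLM.intervalIntegral_comp_comm hi
  simp only [Complex.imCLM_apply] at e0
  rw [h.laplace_k, ← e0, ← intervalIntegral.integral_add_adjacent_intervals
      (hi2.mono_set hsub1) (hi2.mono_set hsub2)]
  have e1 : ∫ v in (0:ℝ)..1, (k v * Complex.exp (-((x:ℂ) * v))).im = 0 := by
    refine intervalIntegral.integral_zero_ae (Eventually.of_forall fun v hv => ?_)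
    rw [uIoc_of_le zero_le_one] at hv
    rw [h.kernel.eq_one v hv.1.le hv.2, one_mul, hre, Complex.ofReal_im]
  have e2 : ∫ v in (1:ℝ)..u, (k v * Complex.exp (-((x:ℂ) * v))).im =
      ∫ v in (1:ℝ)..u, Real.exp (-x * v) := by
    refine intervalIntegral.integral_congr_ae ?_
    have h0 : ({u}ᶜ : Set ℝ) ∈ ae volume := compl_mem_ae_iff.2 (by simp)
    filter_upwards [h0] with v hvb hv
    rw [uIoc_of_le h.one_le] at hv
    rw [hI v hv.1 (lt_of_le_of_ne hv.2 hvb), hre, Complex.I_mul_im, Complex.ofReal_re, neg_mul]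
  have : ∀ t ∈ uIcc 1 u, HasDerivAt (fun t : ℝ => - Real.exp (-x * t) / x)
      (Real.exp (-x * t)) t := fun t _ =>
    (((hasDerivAt_id t).const_mul (-x)).exp.neg.div_const x).congr_deriv
      (by simp only [id]; field_simp)
  rw [e1, e2, intervalIntegral.integral_eq_sub_of_hasDerivAt this
    (Continuous.intervalIntegrable (by fun_prop) _ _)]
  simp; ring

/-- A lower bound for the transform of `t |s(t)|` at `x`, with the subtracted terms moved to the
right in order to stay in the extended nonnegative reals. -/
theorem le_lintegral_mul_exp (h : IsTruncatedPair u k s)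
    (hI : ∀ v, 1 < v → v < u → k v = Complex.I) {x : ℝ} (hx : 0 < x) :
    ENNReal.ofReal (Real.exp Real.eulerMascheroniConstant * x⁻¹) ≤
      (∫⁻ t in Ioi 0, ENNReal.ofReal (t * ‖s t‖ * Real.exp (-x * t))) +
        ENNReal.ofReal (Real.exp Real.eulerMascheroniConstant * (2 + (x ^ 2)⁻¹ / u)) := by
  have hu0 : (0:ℝ) < u := zero_lt_one.trans_le h.one_le
  set G := Real.exp Real.eulerMascheroniConstant
  have hG : 0 < G := Real.exp_pos _
  have hxc : 0 < (x : ℂ).re := by simpa using hx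
  have h1 : ENNReal.ofReal (‖laplace s x‖ * ‖laplace k x‖) ≤
      ∫⁻ t in Ioi 0, ENNReal.ofReal (t * ‖s t‖ * Real.exp (-x * t)) := by
    rw [← norm_mul, ← h.integral_mul_exp_mul hxc, ofReal_norm]
    refine (enorm_integral_le_lintegral_enorm _).trans ?_
    rw [← lintegral_indicator measurableSet_Ioi]
    refine lintegral_mono fun t => ?_
    rw [← ofReal_norm, norm_mul, norm_mul, norm_exp_neg_mul, Complex.norm_real]
    by_cases ht : t ∈ Ioi (0:ℝ)
    · rw [indicator_of_mem ht, Real.norm_of_nonneg (le_of_lt ht)]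
      refine ENNReal.ofReal_le_ofReal (le_of_eq ?_)
      simp; ring
    · rw [indicator_of_notMem ht]
      rcases (not_lt.1 (mt mem_Ioi.2 ht)).eq_or_lt with rfl | ht0
      · simp
      · simp [h.causal_s.eq_zero t ht0]
  have h2 : G * x⁻¹ - G * (2 + (x ^ 2)⁻¹ / u) ≤ ‖laplace s x‖ * ‖laplace k x‖ := by
    have hle : Real.exp (-x * u) ≤ Real.exp (-x) := Real.exp_le_exp.2 (by nlinarith [h.one_le])
    refine le_trans ?_ (mul_le_mul (h.le_norm_laplace_s hI hx) (h.le_norm_laplace_k hI hx)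
      (div_nonneg (sub_nonneg.2 hle) hx.le) (norm_nonneg _))
    rw [← mul_sub, mul_assoc]
    refine mul_le_mul_of_nonneg_left ?_ hG.le
    have h3 : 1 - 2 * x ≤ Real.exp (-x) * Real.exp (-x) := by
      rw [← Real.exp_add]; linarith [Real.add_one_le_exp (-x + -x)]
    have h4 : Real.exp (-x) * Real.exp (-x * u) ≤ x⁻¹ / u := by
      have h5 : Real.exp (-x) ≤ 1 := Real.exp_le_one_iff.2 (by linarith)
      have h6 : Real.exp (-x * u) ≤ x⁻¹ / u := by
        have h7 : Real.exp (-x * u) = (Real.exp (x * u))⁻¹ := by rw [← Real.exp_neg, neg_mul]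
        rw [h7, div_eq_mul_inv, ← mul_inv]
        exact inv_anti₀ (by positivity) (by linarith [Real.add_one_le_exp (x * u)])
      exact (mul_le_of_le_one_left (Real.exp_pos _).le h5).trans h6
    have e : x⁻¹ - (2 + (x ^ 2)⁻¹ / u) = (1 - 2 * x - x⁻¹ / u) / x := by
      field_simp
      ring
    rw [e, mul_div_assoc']
    exact div_le_div_of_nonneg_right (by linarith) hx.le
  calc ENNReal.ofReal (G * x⁻¹)
      ≤ ENNReal.ofReal (‖laplace s x‖ * ‖laplace k x‖ + G * (2 + (x ^ 2)⁻¹ / u)) :=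
        ENNReal.ofReal_le_ofReal (by linarith)
    _ = _ := ENNReal.ofReal_add (by positivity) (by positivity)
    _ ≤ _ := by gcongr

end IsTruncatedPair

namespace IsTruncatedPair

variable {u : ℝ} {k s : ℝ → ℂ}

/-- The logarithmic growth of `∫₀ᵀ |s|` when `k = i` on `(1, u)`. -/
theorem mul_log_le_integral_norm (h : IsTruncatedPair u k s)
    (hI : ∀ v, 1 < v → v < u → k v = Complex.I) {N : ℝ}
    (hB : ∀ z : ℂ, 0 < z.re → ‖laplace s z‖ ≤ N) {T : ℝ} (hT : 1 ≤ T) :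
    Real.exp Real.eulerMascheroniConstant * Real.log T ≤
      (∫ t in Ioc 0 T, ‖s t‖) + N + Real.exp Real.eulerMascheroniConstant * (2 + T / u) := by
  have hu0 : (0:ℝ) < u := zero_lt_one.trans_le h.one_le
  have hT0 : 0 < T := zero_lt_one.trans_le hT
  have hN : 0 ≤ N := (norm_nonneg _).trans (hB 1 (by simp))
  set G := Real.exp Real.eulerMascheroniConstant
  have hG : 0 < G := Real.exp_pos _
  have hTi : T⁻¹ ≤ 1 := inv_le_one_of_one_le₀ hT
  have hTi0 : 0 < T⁻¹ := inv_pos.2 hT0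
  have hsm : AEMeasurable (fun t => ‖s t‖) volume := h.causal_s.meas.norm.aemeasurable
  have hne : ∀ w ∈ uIcc T⁻¹ 1, w ≠ 0 := fun w hw => by
    rw [uIcc_of_le hTi] at hw; exact (hTi0.trans_le hw.1).ne'
  have hi1 : IntervalIntegrable (fun x : ℝ => G * x⁻¹) volume T⁻¹ 1 :=
    ((continuousOn_inv₀.mono hne).const_smul G).intervalIntegrable
  have hi2 : IntervalIntegrable (fun x : ℝ => G * (2 + (x ^ 2)⁻¹ / u)) volume T⁻¹ 1 :=
    (ContinuousOn.mul continuousOn_const (continuousOn_const.add (ContinuousOn.div_const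
      (ContinuousOn.inv₀ (by fun_prop) fun w hw => pow_ne_zero 2 (hne w hw)) u))).intervalIntegrable
  -- Integrate the pointwise lower bound over `x ∈ (1 / T, 1)`.
  have h1 : ENNReal.ofReal (G * Real.log T) ≤
      (∫⁻ x in Ioc T⁻¹ 1, ∫⁻ t in Ioi 0, ENNReal.ofReal (t * ‖s t‖ * Real.exp (-x * t))) +
        ENNReal.ofReal (G * (2 + T / u)) := by
    have e1 : ENNReal.ofReal (G * Real.log T) = ∫⁻ x in Ioc T⁻¹ 1, ENNReal.ofReal (G * x⁻¹) := by
      rw [← ofReal_integral_eq_lintegral_ofReal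
        ((intervalIntegrable_iff_integrableOn_Ioc_of_le hTi).1 hi1),
        ← intervalIntegral.integral_of_le hTi, intervalIntegral.integral_const_mul,
        integral_inv_of_pos hTi0 one_pos, one_div, inv_inv]
      filter_upwards [ae_restrict_mem measurableSet_Ioc] with x hx
      have : 0 < x := hTi0.trans hx.1
      positivity
    have e2 : ∫⁻ x in Ioc T⁻¹ 1, ENNReal.ofReal (G * (2 + (x ^ 2)⁻¹ / u)) ≤
        ENNReal.ofReal (G * (2 + T / u)) := by
      rw [← ofReal_integral_eq_lintegral_ofReal
        ((intervalIntegrable_iff_integrableOn_Ioc_of_le hTi).1 hi2),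
        ← intervalIntegral.integral_of_le hTi, intervalIntegral.integral_const_mul]
      · refine ENNReal.ofReal_le_ofReal (mul_le_mul_of_nonneg_left ?_ hG.le)
        have : ∀ w ∈ uIcc T⁻¹ 1, HasDerivAt (fun x : ℝ => 2 * x - x⁻¹ / u)
            (2 + (w ^ 2)⁻¹ / u) w := fun w hw =>
          (((hasDerivAt_id w).const_mul 2).sub ((hasDerivAt_inv (hne w hw)).div_const u)).congr_deriv
            (by ring)
        rw [intervalIntegral.integral_eq_sub_of_hasDerivAt this]
        · rw [inv_inv]
          have : 0 ≤ (1:ℝ)⁻¹ / u := by positivity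
          linarith
        · exact (continuousOn_const.add (ContinuousOn.div_const
            (ContinuousOn.inv₀ (by fun_prop) fun w hw => pow_ne_zero 2 (hne w hw)) u)).intervalIntegrable
      · filter_upwards with x
        positivity
    rw [e1]
    refine (setLIntegral_mono' measurableSet_Ioc fun x hx =>
      h.le_lintegral_mul_exp hI (hTi0.trans hx.1)).trans ?_
    rw [lintegral_add_right _ (by fun_prop)]
    gcongr
  -- Exchange the integrals; the tail beyond `T` is controlled by the mean square estimate.
  have h2 : (∫⁻ x in Ioc T⁻¹ 1, ∫⁻ t in Ioi 0, ENNReal.ofReal (t * ‖s t‖ * Real.exp (-x * t))) ≤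
      ∫⁻ t in Ioi 0, ENNReal.ofReal (‖s t‖ * Real.exp (-T⁻¹ * t)) := by
    rw [lintegral_lintegral_swap]
    · refine setLIntegral_mono' measurableSet_Ioi fun t ht => ?_
      have ht0 : (0:ℝ) < t := ht
      have : ∀ x, ENNReal.ofReal (t * ‖s t‖ * Real.exp (-x * t)) =
          ENNReal.ofReal (t * ‖s t‖) * ENNReal.ofReal (Real.exp (-t * x)) := fun x => by
        rw [← ENNReal.ofReal_mul (by positivity)]; ring_nf
      simp only [this]
      rw [lintegral_const_mul _ (by fun_prop)]
      calc _ ≤ ENNReal.ofReal (t * ‖s t‖) *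
            ∫⁻ x in Ioi T⁻¹, ENNReal.ofReal (Real.exp (-t * x)) := by
            gcongr
            exact Ioc_subset_Ioi_self
        _ = _ := by
            rw [lintegral_Ioi_exp ht0, ← ENNReal.ofReal_mul (by positivity)]
            congr 1
            rw [show -t * T⁻¹ = -T⁻¹ * t by ring]
            field_simp
    · have h1 : AEMeasurable (fun p : ℝ × ℝ => ‖s p.2‖)
          ((volume.restrict (Ioc T⁻¹ 1)).prod (volume.restrict (Ioi (0:ℝ)))) :=
        hsm.restrict.comp_snd
      exact ((measurable_snd.aemeasurable.mul h1).mul (by fun_prop)).ennreal_ofReal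
  have h3 : ∫⁻ t in Ioi 0, ENNReal.ofReal (‖s t‖ * Real.exp (-T⁻¹ * t)) ≤
      ENNReal.ofReal (∫ t in Ioc 0 T, ‖s t‖) + ENNReal.ofReal N := by
    rw [← Ioc_union_Ioi_eq_Ioi hT0.le, lintegral_union measurableSet_Ioi (Ioc_disjoint_Ioi le_rfl)]
    refine add_le_add ?_ ?_
    · rw [ofReal_integral_eq_lintegral_ofReal (h.integrableOn_norm 0 T)
        (Eventually.of_forall fun t => norm_nonneg _)]
      refine setLIntegral_mono' measurableSet_Ioc fun t ht => ENNReal.ofReal_le_ofReal ?_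
      refine mul_le_of_le_one_right (norm_nonneg _) (Real.exp_le_one_iff.2 ?_)
      have := mul_pos hTi0 ht.1
      linarith
    · calc _ ≤ ∫⁻ t in Ioi T, ENNReal.ofReal T⁻¹ *
            ENNReal.ofReal (t * ‖s t‖ * Real.exp (-T⁻¹ * t)) := by
            refine setLIntegral_mono' measurableSet_Ioi fun t ht => ?_
            rw [← ENNReal.ofReal_mul hTi0.le]
            refine ENNReal.ofReal_le_ofReal ?_
            have h4 : 1 ≤ T⁻¹ * t := by
              rw [inv_mul_eq_div, one_le_div hT0]; exact le_of_lt ht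
            calc _ = 1 * (‖s t‖ * Real.exp (-T⁻¹ * t)) := (one_mul _).symm
              _ ≤ (T⁻¹ * t) * (‖s t‖ * Real.exp (-T⁻¹ * t)) :=
                mul_le_mul_of_nonneg_right h4 (by positivity)
              _ = _ := by ring
        _ = ENNReal.ofReal T⁻¹ *
            ∫⁻ t in Ioi T, ENNReal.ofReal (t * ‖s t‖ * Real.exp (-T⁻¹ * t)) :=
            lintegral_const_mul' _ _ ENNReal.ofReal_ne_top
        _ ≤ ENNReal.ofReal T⁻¹ *
            ∫⁻ t in Ioi 0, ENNReal.ofReal (t * ‖s t‖ * Real.exp (-T⁻¹ * t)) := by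
            gcongr
        _ ≤ ENNReal.ofReal T⁻¹ * (ENNReal.ofReal N *
            ∫⁻ t in Ioi 0, ENNReal.ofReal (Real.exp (-T⁻¹ * t))) := by
            gcongr
            exact h.lintegral_mul_exp_le hTi0 (fun z hz => hB z (by rw [hz]; positivity))
              measurableSet_Ioi Ioc_subset_Ioi_self subset_rfl
        _ = ENNReal.ofReal N := by
            rw [lintegral_Ioi_exp hTi0, ← ENNReal.ofReal_mul hN, ← ENNReal.ofReal_mul hTi0.le]
            congr 1
            rw [mul_zero, Real.exp_zero]
            field_simp
  have hnn : 0 ≤ ∫ t in Ioc 0 T, ‖s t‖ := integral_nonneg fun t => norm_nonneg _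
  have h5 := h1.trans (add_le_add (h2.trans h3) le_rfl)
  rw [← ENNReal.ofReal_add hnn hN, ← ENNReal.ofReal_add (by positivity) (by positivity)] at h5
  exact (ENNReal.ofReal_le_ofReal_iff (by positivity)).1 h5

/-- The mean square estimate at `x = 1 / u` shows that `[T, u]` contributes a bounded amount when
`u / T` and `N` are bounded. -/
theorem integral_tail_norm_le (h : IsTruncatedPair u k s) {N : ℝ}
    (hB : ∀ z : ℂ, 0 < z.re → ‖laplace s z‖ ≤ N) {T : ℝ} (hT : 0 < T) :
    ∫ t in Ioc T u, ‖s t‖ ≤ Real.exp 1 / T * (N * u) := by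
  have hu0 : (0:ℝ) < u := zero_lt_one.trans_le h.one_le
  have hui : 0 < u⁻¹ := inv_pos.2 hu0
  have hN : 0 ≤ N := (norm_nonneg _).trans (hB 1 (by simp))
  have h1 : ENNReal.ofReal (∫ t in Ioc T u, ‖s t‖) ≤
      ENNReal.ofReal (Real.exp 1 / T * (N * u)) := by
    rw [ofReal_integral_eq_lintegral_ofReal (h.integrableOn_norm T u)
        (Eventually.of_forall fun t => norm_nonneg _)]
    calc _ ≤ ∫⁻ t in Ioc T u, ENNReal.ofReal (Real.exp 1 / T) *
            ENNReal.ofReal (t * ‖s t‖ * Real.exp (-u⁻¹ * t)) := by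
          refine setLIntegral_mono' measurableSet_Ioc fun t ht => ?_
          rw [← ENNReal.ofReal_mul (by positivity)]
          refine ENNReal.ofReal_le_ofReal ?_
          have h3 : 1 ≤ t / T := (one_le_div hT).2 ht.1.le
          have h4 : 1 ≤ Real.exp 1 * Real.exp (-u⁻¹ * t) := by
            rw [← Real.exp_add]
            refine Real.one_le_exp ?_
            have : u⁻¹ * t ≤ 1 := by rw [inv_mul_eq_div, div_le_one hu0]; exact ht.2
            linarith
          calc ‖s t‖ = 1 * 1 * ‖s t‖ := by ring
            _ ≤ (t / T) * (Real.exp 1 * Real.exp (-u⁻¹ * t)) * ‖s t‖ := by gcongr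
            _ = _ := by ring
      _ = ENNReal.ofReal (Real.exp 1 / T) *
            ∫⁻ t in Ioc T u, ENNReal.ofReal (t * ‖s t‖ * Real.exp (-u⁻¹ * t)) :=
          lintegral_const_mul' _ _ ENNReal.ofReal_ne_top
      _ ≤ ENNReal.ofReal (Real.exp 1 / T) *
            ∫⁻ t in Ioc 0 u, ENNReal.ofReal (t * ‖s t‖ * Real.exp (-u⁻¹ * t)) := by
          gcongr
      _ ≤ ENNReal.ofReal (Real.exp 1 / T) * (ENNReal.ofReal N *
            ∫⁻ t in Ioc 0 u, ENNReal.ofReal (Real.exp (-u⁻¹ * t))) := by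
          gcongr
          exact h.lintegral_mul_exp_le hui (fun z hz => hB z (by rw [hz]; positivity))
            measurableSet_Ioc subset_rfl Ioc_subset_Ioi_self
      _ ≤ ENNReal.ofReal (Real.exp 1 / T) * (ENNReal.ofReal N *
            ∫⁻ t in Ioi 0, ENNReal.ofReal (Real.exp (-u⁻¹ * t))) := by
          gcongr
          exact Ioc_subset_Ioi_self
      _ = _ := by
          rw [lintegral_Ioi_exp hui, ← ENNReal.ofReal_mul hN, ← ENNReal.ofReal_mul (by positivity)]
          congr 1
          rw [mul_zero, Real.exp_zero, one_div, inv_inv]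
  exact (ENNReal.ofReal_le_ofReal_iff (by positivity)).1 h1

end IsTruncatedPair

/-! ### A kernel for which the bound is nearly attained -/

/-- The conjugate phase of a complex number, so that `phase z * z = ‖z‖` (and `phase 0 = 0`). -/
noncomputable def phase (z : ℂ) : ℂ := (starRingEnd ℂ) z / ‖z‖

theorem mul_phase (z : ℂ) : z * phase z = ‖z‖ := by
  rcases eq_or_ne z 0 with rfl | hz
  · simp [phase]
  · have : (‖z‖ : ℂ) ≠ 0 := by exact_mod_cast norm_ne_zero_iff.2 hz
    rw [phase, mul_div_assoc', Complex.mul_conj', sq, mul_div_cancel_right₀ _ this]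

theorem norm_phase_le (z : ℂ) : ‖phase z‖ ≤ 1 := by
  rw [phase, norm_div, Complex.norm_real, norm_norm, RCLike.norm_conj]
  exact div_self_le_one _

theorem measurable_phase : Measurable phase := by
  unfold phase
  exact Complex.continuous_conj.measurable.div (by fun_prop)

/-- The kernel equal to `1` up to `1`, then to `i` up to `20 T`, and to `0` afterwards. -/
noncomputable def oscillatingKernel (T : ℝ) (v : ℝ) : ℂ :=
  if v ≤ 1 then 1 else if v ≤ 20 * T then Complex.I else 0

/-- The kernel `oscillatingKernel T`, modified on `[19 T, 20 T]` in order to align the phases of the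
values of `σ` on `[0, T]`. -/
noncomputable def resonantKernel (T : ℝ) (σ : ℝ → ℂ) (v : ℝ) : ℂ :=
  if v ≤ 1 then 1 else if v < 19 * T then Complex.I
    else if v ≤ 20 * T then phase (σ (20 * T - v)) else 0

theorem isUnitKernel_oscillatingKernel (T : ℝ) : IsUnitKernel (oscillatingKernel T) where
  measurable := (Measurable.ite measurableSet_Iic measurable_const
    (Measurable.ite measurableSet_Iic measurable_const measurable_const)).aemeasurable
  norm_le t _ := by unfold oscillatingKernel; split_ifs <;> simp
  eq_one t _ h1 := by simp [oscillatingKernel, h1]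

theorem isUnitKernel_resonantKernel (T : ℝ) {σ : ℝ → ℂ} (hσ : Continuous σ) :
    IsUnitKernel (resonantKernel T σ) where
  measurable := (Measurable.ite measurableSet_Iic measurable_const
    (Measurable.ite measurableSet_Iio measurable_const (Measurable.ite measurableSet_Iic
      (measurable_phase.comp (by fun_prop : Continuous fun v => σ (20 * T - v)).measurable)
      measurable_const))).aemeasurable
  norm_le t _ := by
    unfold resonantKernel
    split_ifs
    · simp
    · simp
    · exact norm_phase_le _
    · simp
  eq_one t _ h1 := by simp [resonantKernel, h1]

theorem isRegion_closedBall : IsRegion (Metric.closedBall (0 : ℂ) 1) where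
  closed := Metric.isClosed_closedBall
  convex := convex_closedBall 0 1
  subset_disc := subset_rfl
  one_mem := by simp

theorem IsUnitKernel.isKernelIn_closedBall {χ : ℝ → ℂ} (hχ : IsUnitKernel χ) :
    IsKernelIn (Metric.closedBall (0 : ℂ) 1) χ :=
  ⟨hχ.measurable, fun t ht => by simpa using hχ.norm_le t ht, hχ.eq_one⟩

/-- Numerically the left-hand side is about `9.09`; anything below `19 / 2` suffices for the factor
`10`, since `u / (19 T) = 20 / 19`. -/
theorem exp_pi_div_two_add_le : Real.exp (Real.pi / 2 + 2 / Real.pi) ≤ 47 / 5 := by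
  have h1 := Real.pi_gt_d2
  have h2 := Real.pi_lt_d4
  have h3 : 2 / Real.pi ≤ 0.637 := by
    rw [div_le_iff₀ Real.pi_pos]; linarith
  have h4 : Real.exp (Real.pi / 2 + 2 / Real.pi) ≤ Real.exp (2 + 0.21) :=
    Real.exp_le_exp.2 (by linarith)
  refine h4.trans ?_
  rw [Real.exp_add]
  have h5 : Real.exp 2 = Real.exp 1 * Real.exp 1 := by rw [← Real.exp_add]; norm_num
  have h6 := Real.exp_one_lt_d9
  have h7 : Real.exp 0.21 ≤ 100 / 79 := by
    have h8 := Real.add_one_le_exp (-0.21 : ℝ)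
    rw [Real.exp_neg] at h8
    have h9 := Real.exp_pos 0.21
    rw [show (100 / 79 : ℝ) = (79 / 100)⁻¹ by norm_num]
    exact (le_inv_comm₀ h9 (by norm_num)).2 (le_trans (by norm_num) h8)
  have h10 : Real.exp 2 ≤ 7.39 := by
    rw [h5]; nlinarith [Real.exp_pos 1]
  calc _ ≤ (7.39 : ℝ) * (100 / 79) := mul_le_mul h10 h7 (Real.exp_pos _).le (by norm_num)
    _ ≤ _ := by norm_num

/-- The value at `20 T` of the solution for the resonant kernel is at least `e^γ log T / (20 T)`, up
to a bounded error in the numerator. -/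
theorem exists_resonant_lower_bound : ∃ K : ℝ, ∀ T : ℝ, 1 ≤ T → ∃ χ σ : ℝ → ℂ,
    IsUnitKernel χ ∧ IsSolution χ σ ∧
    Real.log (19 * T) - (Real.pi / 2 + 2 / Real.pi) ≤ minDistance χ (20 * T) ∧
    Real.exp Real.eulerMascheroniConstant * (Real.log T - K) ≤ 20 * T * ‖σ (20 * T)‖ := by
  set G := Real.exp Real.eulerMascheroniConstant with hG
  set c := Real.pi / 2 + 2 / Real.pi with hc
  have hexp : ∀ {a : ℝ}, 0 < a →
      Real.exp (Real.eulerMascheroniConstant - (Real.log a - c)) = G * Real.exp c / a := by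
    intro a ha
    rw [show Real.eulerMascheroniConstant - (Real.log a - c) =
      Real.eulerMascheroniConstant + c - Real.log a by ring, Real.exp_sub, Real.exp_add,
      Real.exp_log ha]
  refine ⟨Real.exp c + (2 + 1 / 20) + 400 / 19 * Real.exp 1 * Real.exp c, fun T hT => ?_⟩
  have hT0 : 0 < T := zero_lt_one.trans_le hT
  have hu1 : 1 ≤ 20 * T := by linarith
  have hu0 : 0 < 20 * T := by linarith
  have h0 := isUnitKernel_oscillatingKernel T
  obtain ⟨σ₀, hσ₀c, hσ₀⟩ := h0.exists_isSolution
  have h1 := isUnitKernel_resonantKernel T hσ₀c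
  obtain ⟨σ, -, hσ⟩ := h1.exists_isSolution
  have hagree : ∀ t, 0 ≤ t → t ≤ T → σ t = σ₀ t := fun t ht htT => by
    refine hσ.eq_of_eqOn h1 hσ₀ (U := 19 * T) (fun v _ hv => ?_) ht (by linarith)
    simp [resonantKernel, oscillatingKernel, hv, show v ≤ 20 * T by linarith]
  have P0 := hσ₀.isTruncatedPair h0 hu1 fun t ht => by
    simp [oscillatingKernel, not_le.2 ht, show ¬ t ≤ 1 by linarith]
  have P1 := hσ.isTruncatedPair h1 hu1 fun t ht => by
    simp [resonantKernel, not_le.2 ht, show ¬ t ≤ 1 by linarith, show ¬ t < 19 * T by linarith]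
  have hI0 : ∀ v, 1 < v → v < 20 * T →
      (Ici (0:ℝ)).indicator (oscillatingKernel T) v = Complex.I := fun v hv1 hv2 => by
    rw [indicator_of_mem (mem_Ici.2 (by linarith))]
    simp [oscillatingKernel, not_le.2 hv1, hv2.le]
  have hI1 : ∀ v, 1 < v → v < 19 * T → resonantKernel T σ₀ v = Complex.I := fun v hv1 hv2 => by
    simp [resonantKernel, not_le.2 hv1, hv2]
  have hI1' : ∀ v, 1 < v → v < 19 * T →
      (Ici (0:ℝ)).indicator (resonantKernel T σ₀) v = Complex.I := fun v hv1 hv2 => by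
    rw [indicator_of_mem (mem_Ici.2 (by linarith)), hI1 v hv1 hv2]
  have hB0 : ∀ z : ℂ, 0 < z.re → ‖laplace ((Ici (0:ℝ)).indicator σ₀) z‖ ≤ G * Real.exp c :=
    fun z hz => by
      have := P0.norm_laplace_le_of_le (P0.kernel.log_sub_le_twistedDistance hu1 le_rfl hI0) hz
      rwa [← hc, hexp hu0, mul_div_cancel₀ _ hu0.ne'] at this
  have hB1 : ∀ z : ℂ, 0 < z.re →
      ‖laplace ((Ici (0:ℝ)).indicator σ) z‖ ≤ 20 / 19 * (G * Real.exp c) := fun z hz => by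
    have := P1.norm_laplace_le_of_le
      (P1.kernel.log_sub_le_twistedDistance (by linarith) (by linarith) hI1') hz
    rw [← hc, hexp (by linarith)] at this
    refine this.trans (le_of_eq ?_)
    field_simp
  have hmain := P0.mul_log_le_integral_norm hI0 hB0 hT
  have htail := P1.integral_tail_norm_le hB1 hT0
  have hn0 : ∫ t in Ioc 0 T, ‖(Ici (0:ℝ)).indicator σ₀ t‖ = ∫ t in (0:ℝ)..T, ‖σ₀ t‖ := by
    rw [intervalIntegral.integral_of_le hT0.le]
    refine setIntegral_congr_fun measurableSet_Ioc fun t ht => ?_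
    rw [indicator_of_mem (mem_Ici.2 ht.1.le)]
  have hn1 : ∫ t in Ioc T (20 * T), ‖(Ici (0:ℝ)).indicator σ t‖ =
      ∫ t in T..(20 * T), ‖σ t‖ := by
    rw [intervalIntegral.integral_of_le (by linarith)]
    refine setIntegral_congr_fun measurableSet_Ioc fun t ht => ?_
    rw [indicator_of_mem (mem_Ici.2 (hT0.trans ht.1).le)]
  rw [hn0] at hmain
  rw [hn1] at htail
  refine ⟨resonantKernel T σ₀, σ, h1, hσ, le_ciInf fun y =>
    h1.log_sub_le_twistedDistance (by linarith) (by linarith) hI1 y, ?_⟩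
  -- Split the equation at `T`; on `[0, T]` the integrand is `|σ₀|`.
  have hint := h1.intervalIntegrable_mul hu0.le (hσ.integrable _ hu0.le)
  have hint1 : IntervalIntegrable (fun t => σ t * resonantKernel T σ₀ (20 * T - t)) volume 0 T :=
    hint.mono_set (by
      rw [uIcc_of_le hT0.le, uIcc_of_le hu0.le]; exact Icc_subset_Icc_right (by linarith))
  have hint2 : IntervalIntegrable (fun t => σ t * resonantKernel T σ₀ (20 * T - t)) volume
      T (20 * T) :=
    hint.mono_set (by
      rw [uIcc_of_le (by linarith : T ≤ 20 * T), uIcc_of_le hu0.le]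
      exact Icc_subset_Icc_left hT0.le)
  have hσint : IntervalIntegrable σ volume T (20 * T) :=
    (hσ.integrable _ hu0.le).mono_set (by
      rw [uIcc_of_le (by linarith : T ≤ 20 * T), uIcc_of_le hu0.le]
      exact Icc_subset_Icc_left hT0.le)
  have e1 : ∫ t in (0:ℝ)..T, σ t * resonantKernel T σ₀ (20 * T - t) =
      ((∫ t in (0:ℝ)..T, ‖σ₀ t‖ : ℝ) : ℂ) := by
    rw [← intervalIntegral.integral_ofReal]
    refine intervalIntegral.integral_congr fun t ht => ?_
    rw [uIcc_of_le hT0.le] at ht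
    have h3 : resonantKernel T σ₀ (20 * T - t) = phase (σ₀ t) := by
      unfold resonantKernel
      rw [if_neg (by linarith [ht.2]), if_neg (by linarith [ht.2]), if_pos (by linarith [ht.1]),
        sub_sub_cancel]
    rw [h3, hagree t ht.1 ht.2, mul_phase]
  have e2 : ‖∫ t in T..(20 * T), σ t * resonantKernel T σ₀ (20 * T - t)‖ ≤
      ∫ t in T..(20 * T), ‖σ t‖ := by
    refine intervalIntegral.norm_integral_le_of_norm_le (by linarith)
      (Eventually.of_forall fun t ht => ?_) hσint.norm
    rw [norm_mul]
    exact mul_le_of_le_one_right (norm_nonneg _) (h1.norm_le _ (by linarith [ht.2]))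
  have e3 := hσ.equation (20 * T) hu0.le
  rw [← intervalIntegral.integral_add_adjacent_intervals hint1 hint2, e1] at e3
  have e4 : 20 * T * ‖σ (20 * T)‖ = ‖((20 * T : ℝ) : ℂ) * σ (20 * T)‖ := by
    rw [norm_mul, Complex.norm_real, Real.norm_of_nonneg hu0.le]
  have hnn : 0 ≤ ∫ t in (0:ℝ)..T, ‖σ₀ t‖ :=
    intervalIntegral.integral_nonneg hT0.le fun t _ => norm_nonneg _
  have e5 := norm_sub_le_norm_add ((∫ t in (0:ℝ)..T, ‖σ₀ t‖ : ℝ) : ℂ)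
    (∫ t in T..(20 * T), σ t * resonantKernel T σ₀ (20 * T - t))
  rw [← e3, ← e4, Complex.norm_real, Real.norm_of_nonneg hnn] at e5
  have e6 : T / (20 * T) = 1 / 20 := by field_simp
  have e7 : Real.exp 1 / T * (20 / 19 * (G * Real.exp c) * (20 * T)) =
      G * (400 / 19 * Real.exp 1 * Real.exp c) := by field_simp; ring
  rw [e6] at hmain
  rw [e7] at htail
  linarith

/-- For large `T` the bounded errors are absorbed because `2 / 19 * e^{π / 2 + 2 / π} < 1`. -/
theorem exists_near_extremal (m₀ : ℝ) : ∃ (χ σ : ℝ → ℂ) (u : ℝ), IsUnitKernel χ ∧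
    IsSolution χ σ ∧ 0 ≤ u ∧ m₀ < minDistance χ u ∧
    (minDistance χ u + 12 / 7) *
      Real.exp (Real.eulerMascheroniConstant - minDistance χ u) / 10 ≤ ‖σ u‖ := by
  obtain ⟨K, hK⟩ := exists_resonant_lower_bound
  set G := Real.exp Real.eulerMascheroniConstant with hG
  have hG0 : 0 < G := Real.exp_pos _
  set c := Real.pi / 2 + 2 / Real.pi with hc
  have hc0 : 0 < c := by positivity
  set A := Real.log 19 - c + 12 / 7 with hA
  set L := max (max (m₀ + c + 1) c) (max 0 (95 * (|K| + |A|))) with hL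
  have hL1 : m₀ + c + 1 ≤ L := (le_max_left _ _).trans (le_max_left _ _)
  have hL2 : c ≤ L := (le_max_right _ _).trans (le_max_left _ _)
  have hL3 : 0 ≤ L := (le_max_left _ _).trans (le_max_right _ _)
  have hL4 : 95 * (|K| + |A|) ≤ L := (le_max_right _ _).trans (le_max_right _ _)
  obtain ⟨χ, σ, hχ, hσ, hM, hlow⟩ := hK (Real.exp L) (Real.one_le_exp hL3)
  have hT0 := Real.exp_pos L
  set T := Real.exp L with hT
  have hlogT : Real.log T = L := Real.log_exp L
  have hlog : Real.log (19 * T) = Real.log 19 + L := by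
    rw [Real.log_mul (by norm_num) hT0.ne', hlogT]
  have h19 : 0 < Real.log 19 := Real.log_pos (by norm_num)
  rw [hlogT] at hlow
  have hm0 : 0 ≤ Real.log (19 * T) - c := by linarith
  refine ⟨χ, σ, 20 * T, hχ, hσ, by positivity, by linarith, ?_⟩
  have h1 := add_mul_exp_antitone (c := Real.eulerMascheroniConstant) hm0 hM
  have h2 : Real.exp (Real.eulerMascheroniConstant - (Real.log (19 * T) - c)) =
      G * Real.exp c / (19 * T) := by
    rw [show Real.eulerMascheroniConstant - (Real.log (19 * T) - c) =
      Real.eulerMascheroniConstant + c - Real.log (19 * T) by ring, Real.exp_sub, Real.exp_add,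
      Real.exp_log (by positivity)]
  rw [h2] at h1
  have h3 : (Real.log (19 * T) - c + 12 / 7) * (G * Real.exp c / (19 * T)) / 10 * (20 * T) =
      G * ((L + A) * (2 / 19 * Real.exp c)) := by
    rw [hlog, hA]; field_simp; ring
  have h4 : (L + A) * (2 / 19 * Real.exp c) ≤ L - K := by
    have hLA : 0 ≤ L + A := by linarith
    have h5 : 2 / 19 * Real.exp c ≤ 94 / 95 := by linarith [exp_pi_div_two_add_le]
    have h6 := mul_le_mul_of_nonneg_left h5 hLA
    linarith [le_abs_self K, le_abs_self A, abs_nonneg A]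
  have h7 : (minDistance χ (20 * T) + 12 / 7) *
      Real.exp (Real.eulerMascheroniConstant - minDistance χ (20 * T)) / 10 * (20 * T) ≤
        ‖σ (20 * T)‖ * (20 * T) := by
    calc _ ≤ (Real.log (19 * T) - c + 12 / 7) * (G * Real.exp c / (19 * T)) / 10 * (20 * T) := by
          gcongr
      _ ≤ G * (L - K) := by rw [h3]; exact mul_le_mul_of_nonneg_left h4 hG0.le
      _ ≤ _ := by rw [mul_comm _ (20 * T)]; exact hlow
  exact le_of_mul_le_mul_right h7 (by positivity)

end MeanValue

theorem mainTheorem10 :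
    (∀ (D : Set ℂ) (χ σ : ℝ → ℂ), MeanValue.IsRegion D → MeanValue.IsKernelIn D χ →
      MeanValue.IsSolution χ σ → ∀ u : ℝ, 0 ≤ u →
        IsLeast (Set.range (MeanValue.twistedDistance χ u)) (MeanValue.minDistance χ u) ∧
        ‖σ u‖ ≤ (MeanValue.minDistance χ u + 12 / 7) *
          Real.exp (Real.eulerMascheroniConstant - MeanValue.minDistance χ u)) ∧
    (∀ m₀ : ℝ, ∃ (D : Set ℂ) (χ σ : ℝ → ℂ) (u : ℝ), MeanValue.IsRegion D ∧
      MeanValue.IsKernelIn D χ ∧ MeanValue.IsSolution χ σ ∧ 0 ≤ u ∧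
        m₀ < MeanValue.minDistance χ u ∧
        (MeanValue.minDistance χ u + 12 / 7) *
          Real.exp (Real.eulerMascheroniConstant - MeanValue.minDistance χ u) / 10 ≤ ‖σ u‖) := by
  refine ⟨fun D χ σ hD hχ hσ u hu => ?_, fun m₀ => ?_⟩
  · have h := hχ.isUnitKernel hD
    exact ⟨h.isLeast_minDistance hu, hσ.norm_le h hu⟩
  · obtain ⟨χ, σ, u, hχ, hσ, hu, hm, hlow⟩ := MeanValue.exists_near_extremal m₀
    exact ⟨_, χ, σ, u, MeanValue.isRegion_closedBall, hχ.isKernelIn_closedBall, hσ, hu, hm, hlow⟩
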